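/- **Proposition 3.2.** Let $\mathbb R^5_1$ be $\mathbb R^5$ with $\langle x,y\rangle=\sum_{i=1}^4x^iy^i-x^5y^5$, let $\mathbb H^4=\{x\in\mathbb R^5_1:\langle x,x\rangle=-1,\ x^5>0\}$, with inclusion $\iota:\mathbb H^4\to\mathbb R^5_1$ and Levi-Civita connection $\tilde\nabla$. Let $M^2$ be a connected oriented smooth surface and $\varphi:M\to\mathbb H^4$ a smooth immersion, with $M$ carrying the induced metric; let $B$ be its second fundamental form, $H=\frac12\operatorname{trace}B$ its mean curvature vector field, $f=|H|$, and $\nabla^\perp$ its normal connection. Assume that $\varphi$ is a PNMC biconservative immersion, that is: $f>0$ and $\operatorname{grad}f\neq0$ everywhere; $\nabla^\perp(H/|H|)=0$; the bitension field $\tau_2(\varphi)=-\Delta^\varphi\tau(\varphi)-\operatorname{trace}R^{\mathbb H^4}(d\varphi\,\cdot,\tau(\varphi))d\varphi\,\cdot$, where $\tau(\varphi)=2H$ and $\Delta^\varphi$ is the rough Laplacian, $\Delta^\varphi=-\operatorname{trace}(\nabla^\varphi\nabla^\varphi-\nabla^\varphi_\nabla)$, has zero tangential part; and no nonempty open subset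 of $M$ is mapped into a totally geodesic hypersurface $\mathbb H^3=\mathbb H^4\cap\Pi$ of $\mathbb H^4$ ($\Pi$ a hyperplane through the origin that meets $\mathbb H^4$). Let $E_1=\operatorname{grad}f/|\operatorname{grad}f|$ and $E_3=H/f$, and let $E_2$, $E_4$ be smooth unit fields completing these to orthonormal frames $\{E_1,E_2\}$ of $TM$ and $\{E_3,E_4\}$ of the normal bundle of $M$ in $\mathbb H^4$. Then there are constants $c\in\mathbb R\setminus\{0\}$ and $C\in\mathbb R$, namely those for which the shape operator of $E_4$ has, with respect to $\{E_1,E_2\}$, the matrix $\operatorname{diag}(cf^{3/2},-cf^{3/2})$ and $$E_1f=\tfrac43 f\sqrt{1+9Cf^{3/2}-9f^2-c^2f^3}$$ on all of $M$, such that for every integral curve $\sigma:J\to M$ of $E_1$ on a nonempty open interval $J$, with $\tilde\sigma=\varphi\circ\sigma$ and $\hat\sigma=\iota\circ\tilde\sigma$: (i) $E_2$, viewed as a vector in $\mathbb R^5_1$, is constant along $\hat\sigma$; (ii) $\tilde\sigma$ lies in a totally geodesic hypersurface $\mathbb H^3=\mathbb H^4\cap\Pi$, where the hyperplane $\Pi\subset\mathbb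 R^5_1$ contains the origin and is orthogonal to $E_2$ along $\sigma$; (iii) $\hat\sigma$ does not lie in any two-dimensional affine subspace of $\mathbb R^5_1$; (iv) the curvature $\kappa=|\tilde\nabla_{\tilde\sigma'}\tilde\sigma'|$ and the torsion $\tau=|\tilde\nabla_{\tilde\sigma'}V_2+\kappa\tilde\sigma'|$, with $V_2=\frac1\kappa\tilde\nabla_{\tilde\sigma'}\tilde\sigma'$, of the unit speed curve $\tilde\sigma$ are $$\kappa(u)=f(u)\sqrt{1+c^2f(u)},\qquad \tau(u)=\frac{2|c|\sqrt{f(u)}}{3(1+c^2f(u))}\sqrt{1+9Cf^{3/2}(u)-9f^2(u)-c^2f^3(u)},$$ where $f(u)=f(\sigma(u))$. -/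

import Mathlib

open scoped Manifold ContDiff

noncomputable section

namespace Biconservative

/-! ### Minkowski space and the hyperboloid model -/

/-- The vector space underlying the Minkowski space `ℝ⁵₁`; the coordinate of index `4` is the
timelike one. -/
abbrev R51 : Type := Fin 5 → ℝ

/-- The Minkowski form `x¹y¹ + x²y² + x³y³ + x⁴y⁴ - x⁵y⁵`. -/
def mink (x y : R51) : ℝ := x 0 * y 0 + x 1 * y 1 + x 2 * y 2 + x 3 * y 3 - x 4 * y 4

/-- The hyperbolic space `ℍ⁴`: the upper sheet of the hyperboloid. -/
def H4 : Set R51 := {x | mink x x = -1 ∧ 0 < x 4}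

/-- Totally geodesic hypersurfaces `ℍ³` of `ℍ⁴`: the nonempty intersections of `ℍ⁴` with a
hyperplane of `ℝ⁵` through the origin. -/
def IsTotallyGeodesicH3 (S : Set R51) : Prop :=
  ∃ P : Submodule ℝ R51, Module.finrank ℝ P = 4 ∧ S = H4 ∩ (P : Set R51) ∧ S.Nonempty

/-- Orthogonal projection of `v` onto the tangent space `T_q ℍ⁴ = q^⊥`, for `q ∈ ℍ⁴`. -/
def projH4 (q v : R51) : R51 := v + mink v q • q

/-- The curvature tensor `R(x, y) z` of `ℍ⁴` (constant sectional curvature `-1`, with the convention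
`R(X,Y)Z = [∇_X, ∇_Y]Z - ∇_{[X,Y]}Z`), for `x y z` tangent to `ℍ⁴` at one point. -/
def curvH4 (x y z : R51) : R51 := -(mink y z • x - mink x z • y)

/-! ### Local formulas for a parametrized surface in `ℍ⁴`

`X` is a map from (an open set of) `ℝ²` to `ℍ⁴ ⊆ ℝ⁵₁`. All indices run over `Fin 2`. -/

/-- The parameter plane `ℝ²`. -/
abbrev E2 : Type := EuclideanSpace ℝ (Fin 2)

/-- The standard basis of `ℝ²`. -/
def stdVec (i : Fin 2) : E2 := EuclideanSpace.single i 1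

/-- The partial derivative `∂ᵢF`. -/
def pd {G : Type*} [NormedAddCommGroup G] [NormedSpace ℝ G] (i : Fin 2) (F : E2 → G) (x : E2) : G :=
  fderiv ℝ F x (stdVec i)

/-- The induced metric `g_{ij} = ⟨∂ᵢX, ∂ⱼX⟩`. -/
def metric (X : E2 → R51) (x : E2) : Matrix (Fin 2) (Fin 2) ℝ :=
  Matrix.of fun i j => mink (pd i X x) (pd j X x)

/-- The Christoffel symbols `Γᵏᵢⱼ = ½ gᵏˡ (∂ᵢ g_{jl} + ∂ⱼ g_{il} - ∂ₗ g_{ij})` of the induced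
metric. -/
def christoffel (X : E2 → R51) (k i j : Fin 2) (x : E2) : ℝ :=
  ∑ l, (metric X x)⁻¹ k l * ((1 / 2 : ℝ) *
    (pd i (fun y => metric X y j l) x + pd j (fun y => metric X y i l) x
      - pd l (fun y => metric X y i j) x))

/-- The covariant derivative `∇^φ_{∂ᵢ} V` of a section `V` of the pull-back of `T ℍ⁴` by `X`,
induced by the Levi-Civita connection of `ℍ⁴`. -/
def covD (X : E2 → R51) (i : Fin 2) (V : E2 → R51) (x : E2) : R51 :=
  projH4 (X x) (pd i V x)

/-- The second fundamental form
`B(∂ᵢ, ∂ⱼ) = ∇^φ_{∂ᵢ} (dX ∂ⱼ) - dX (∇_{∂ᵢ} ∂ⱼ)` of the surface in `ℍ⁴`. -/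
def sff (X : E2 → R51) (i j : Fin 2) (x : E2) : R51 :=
  covD X i (pd j X) x - ∑ k, christoffel X k i j x • pd k X x

/-- The tension field `τ = trace B = 2H`. -/
def tension (X : E2 → R51) (x : E2) : R51 :=
  ∑ i, ∑ j, (metric X x)⁻¹ i j • sff X i j x

/-- The rough Laplacian `Δ^φ V = - trace (∇^φ ∇^φ - ∇^φ_∇) V`. -/
def roughLaplacian (X : E2 → R51) (V : E2 → R51) (x : E2) : R51 :=
  -∑ i, ∑ j, (metric X x)⁻¹ i j •
    (covD X i (covD X j V) x - ∑ k, christoffel X k i j x • covD X k V x)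

/-- The bitension field `τ₂ = -Δ^φ τ - trace R(dX ·, τ) dX ·`. -/
def bitension (X : E2 → R51) (x : E2) : R51 :=
  -roughLaplacian X (tension X) x
    - ∑ i, ∑ j, (metric X x)⁻¹ i j • curvH4 (pd i X x) (tension X x) (pd j X x)

/-! ### Immersed surfaces in `ℍ⁴` -/

section Surface

variable {M : Type*} [TopologicalSpace M] [ChartedSpace E2 M]

/-- The induced metric on `T_p M`. -/
def indMetric (Φ : M → R51) (p : M) (v w : TangentSpace (𝓡 2) p) : ℝ :=
  mink (mvfderiv (𝓡 2) Φ p v) (mvfderiv (𝓡 2) Φ p w)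

/-- The basis of `T_p M` given by the preferred chart at `p`. -/
def tangentBasis (p : M) (i : Fin 2) : TangentSpace (𝓡 2) p := stdVec i

/-- The gradient `gⁱʲ (∂ⱼ h) ∂ᵢ` of a function `h` with respect to the induced metric. -/
def grad (Φ : M → R51) (h : M → ℝ) (p : M) : TangentSpace (𝓡 2) p :=
  ∑ i, ∑ j, ((Matrix.of fun a b => indMetric Φ p (tangentBasis p a) (tangentBasis p b))⁻¹ i j
    * mvfderiv (𝓡 2) h p (tangentBasis p j)) • tangentBasis p i

/-- The components of a tangent vector with respect to `tangentBasis p`. -/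
def tangentCoord (p : M) (i : Fin 2) (v : TangentSpace (𝓡 2) p) : ℝ :=
  (EuclideanSpace.proj i : E2 →L[ℝ] ℝ) v

/-- The second fundamental form `B_p(v, w)` of the surface in `ℍ⁴`, computed in the preferred chart
at `p`. -/
def secondFF (Φ : M → R51) (p : M) (v w : TangentSpace (𝓡 2) p) : R51 :=
  ∑ i, ∑ j, (tangentCoord p i v * tangentCoord p j w) •
    sff (Φ ∘ (chartAt E2 p).symm) i j (chartAt E2 p p)

/-- The mean curvature vector field `H = (trace B)/2`. -/
def meanCurvVec (Φ : M → R51) (p : M) : R51 :=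
  (1 / 2 : ℝ) • tension (Φ ∘ (chartAt E2 p).symm) (chartAt E2 p p)

/-- The mean curvature function `f = |H|`. -/
def meanCurv (Φ : M → R51) (p : M) : ℝ :=
  Real.sqrt (mink (meanCurvVec Φ p) (meanCurvVec Φ p))

/-- The unit vector field `E₁ = grad f / |grad f|`. -/
def vE1 (Φ : M → R51) (p : M) : TangentSpace (𝓡 2) p :=
  (Real.sqrt (indMetric Φ p (grad Φ (meanCurv Φ) p) (grad Φ (meanCurv Φ) p)))⁻¹ •
    grad Φ (meanCurv Φ) p

/-- The normalized mean curvature vector field `E₃ = H / f`. -/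
def vE3 (Φ : M → R51) (p : M) : R51 := (meanCurv Φ p)⁻¹ • meanCurvVec Φ p

/-- `ν` belongs to the normal space `N_p M` of the surface in `ℍ⁴`. -/
def IsNormalAt (Φ : M → R51) (p : M) (ν : R51) : Prop :=
  mink ν (Φ p) = 0 ∧ ∀ v : TangentSpace (𝓡 2) p, mink ν (mvfderiv (𝓡 2) Φ p v) = 0

/-- A PNMC biconservative surface in `ℍ⁴` (with the induced metric): an immersion with positive mean
curvature function, nowhere vanishing gradient of the mean curvature function, parallel normalized
mean curvature vector field and `τ₂^⊤ = 0`, no open part of which lies in a totally geodesic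
`ℍ³`. -/
structure IsPNMCBiconservative (Φ : M → R51) : Prop where
  smooth : ContMDiff (𝓡 2) 𝓘(ℝ, R51) ∞ Φ
  mem_H4 : ∀ p, Φ p ∈ H4
  immersion : ∀ p, Function.Injective (mvfderiv (𝓡 2) Φ p)
  meanCurv_pos : ∀ p, 0 < meanCurv Φ p
  grad_ne_zero : ∀ p, grad Φ (meanCurv Φ) p ≠ 0
  /-- `∇^⊥ E₃ = 0`: the derivatives of `E₃` have no component in the normal bundle. -/
  parallel : ∀ p (v : TangentSpace (𝓡 2) p) (ν : R51), IsNormalAt Φ p ν →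
    mink (mvfderiv (𝓡 2) (vE3 Φ) p v) ν = 0
  /-- `τ₂^⊤ = 0`, in every chart of the atlas. -/
  biconservative : ∀ e ∈ atlas E2 M, ∀ x ∈ e.target, ∀ k,
    mink (bitension (Φ ∘ e.symm) x) (pd k (Φ ∘ e.symm) x) = 0
  full : ∀ U : Set M, IsOpen U → U.Nonempty → ∀ S, IsTotallyGeodesicH3 S → ¬ Set.MapsTo Φ U S

/-- `E₂` completes `E₁` to a smooth orthonormal frame field `{E₁, E₂}` of `TM`. Such a field is the
same thing as an orientation of `M`. -/
structure IsE2 (Φ : M → R51) (vE2 : (p : M) → TangentSpace (𝓡 2) p) : Prop where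
  smooth : ContMDiff (𝓡 2) 𝓘(ℝ, R51) ∞ fun p => mvfderiv (𝓡 2) Φ p (vE2 p)
  unit : ∀ p, indMetric Φ p (vE2 p) (vE2 p) = 1
  orth : ∀ p, indMetric Φ p (vE1 Φ p) (vE2 p) = 0

/-- `E₄` completes `E₃` to a smooth orthonormal frame field `{E₃, E₄}` of the normal bundle. -/
structure IsE4 (Φ : M → R51) (vE4 : M → R51) : Prop where
  smooth : ContMDiff (𝓡 2) 𝓘(ℝ, R51) ∞ vE4
  normal : ∀ p, IsNormalAt Φ p (vE4 p)
  unit : ∀ p, mink (vE4 p) (vE4 p) = 1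
  orth : ∀ p, mink (vE3 Φ p) (vE4 p) = 0

end Surface

/-! ### Unit speed curves in `ℍ⁴` -/

/-- The covariant derivative, for the Levi-Civita connection of `ℍ⁴`, of a vector field `V` along
a curve `γ` in `ℍ⁴`. -/
def covAlong (γ V : ℝ → R51) (u : ℝ) : R51 := projH4 (γ u) (deriv V u)

/-- The curvature `κ = |∇_T T|`, `T = γ'`, of a unit speed curve in `ℍ⁴`. -/
def curvature (γ : ℝ → R51) (u : ℝ) : ℝ :=
  Real.sqrt (mink (covAlong γ (deriv γ) u) (covAlong γ (deriv γ) u))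

/-- The principal normal `N = ∇_T T / κ`. -/
def principalNormal (γ : ℝ → R51) (u : ℝ) : R51 :=
  (curvature γ u)⁻¹ • covAlong γ (deriv γ) u

/-- The (nonnegative) torsion `|∇_T N + κ T|` of a unit speed curve in `ℍ⁴`. -/
def torsion (γ : ℝ → R51) (u : ℝ) : ℝ :=
  Real.sqrt (mink (covAlong γ (principalNormal γ) u + curvature γ u • deriv γ u)
    (covAlong γ (principalNormal γ) u + curvature γ u • deriv γ u))

end Biconservative

end

open Biconservative

namespace Biconservative

/-! ### The Minkowski form -/

/-! The surface is studied by moving frames in the flat space $\mathbb R^5_1$. Along it the position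
vector $X$ and $E_1,\dots,E_4$ form a Minkowski-orthonormal frame, and commuting flat derivatives of
frame fields (`structure_eq`) yields all Gauss, Codazzi and Ricci equations.

The local theory determines the connection matrix. Combined with the Codazzi equation and the trace
of $A_3$, the condition $\tau_2^\top=0$ becomes $A_3\,\mathrm{grad} f=-f\,\mathrm{grad} f$, so
$A_3=\mathrm{diag}(-f,3f)$ (`shape_three`). Since $E_3$ is parallel, the Ricci equation says that
$A_3$ and $A_4$ commute. The eigenvalues of $A_3$ are distinct, so $A_4=\mathrm{diag}(k,-k)$
(`shape_four`). Codazzi for $E_3$ gives $\nabla_{E_1}E_1=0$ and $E_1f=-\frac43fw$ with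
$w=\langle\nabla_{E_2}E_1,E_2\rangle$ (`geodesic`). Codazzi for $E_4$ gives $E_1k=-2kw$, and the
Gauss equation gives $E_1w=1+3f^2+k^2-w^2$; the $E_2$-derivatives of $f,k,w$ all vanish
(`gauss_codazzi`).

Consequently $kf^{-3/2}$ and $(w^2+9f^2+k^2-1)f^{-3/2}$ are constant on the connected surface; they
are $c$ and $9C$. If $c=0$, then $E_4$ would be a constant vector and $M$ would lie in the
hyperplane $E_4^\perp$, which is excluded (`exists_shape_const`). Since $E_1f>0$, $w$ is negative,
which selects the root in the formula for $E_1f$ (`meanCurv_ode`).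

Along an integral curve of $E_1$ the flat derivative of $E_2$ is zero, which gives (i), and $\langle
X,E_2\rangle=0$ then gives (ii). The vectors $X,E_1,E_3,E_4$ satisfy a linear system with
coefficients $f$ and $k=cf^{3/2}$ (`FrameCurve`). Curvature and torsion are read off from it, and
$f'>0$ makes the first three derivatives of the curve linearly independent, which gives (iii).

Most of the remaining work passes between the chart definitions on $M$ and this local theory: the
second fundamental form and the tension do not depend on the chart (`sffq_comp`, `tension_comp`),
and tangential biconservativity is expressed by flat derivatives along the frame
(`bitension_tangent`). -/

theorem mink_comm (x y : R51) : mink x y = mink y x := by simp only [mink]; ring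

@[simp] theorem mink_add_left (x y z : R51) : mink (x + y) z = mink x z + mink y z := by
  simp only [mink, Pi.add_apply]; ring

@[simp] theorem mink_add_right (x y z : R51) : mink x (y + z) = mink x y + mink x z := by
  simp only [mink, Pi.add_apply]; ring

@[simp] theorem mink_smul_left (r : ℝ) (x y : R51) : mink (r • x) y = r * mink x y := by
  simp only [mink, Pi.smul_apply, smul_eq_mul]; ring

@[simp] theorem mink_smul_right (r : ℝ) (x y : R51) : mink x (r • y) = r * mink x y := by
  simp only [mink, Pi.smul_apply, smul_eq_mul]; ring

@[simp] theorem mink_neg_left (x y : R51) : mink (-x) y = -mink x y := by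
  simp only [mink, Pi.neg_apply]; ring

@[simp] theorem mink_sub_left (x y z : R51) : mink (x - y) z = mink x z - mink y z := by
  simp only [mink, Pi.sub_apply]; ring

@[simp] theorem mink_sub_right (x y z : R51) : mink x (y - z) = mink x y - mink x z := by
  simp only [mink, Pi.sub_apply]; ring

@[simp] theorem mink_zero_left (x : R51) : mink 0 x = 0 := by simp [mink]

@[simp] theorem mink_zero_right (x : R51) : mink x 0 = 0 := by simp [mink]

/-- The Minkowski form as a continuous bilinear map. -/
noncomputable def minkL : R51 →L[ℝ] R51 →L[ℝ] ℝ :=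
  (LinearMap.mk₂ ℝ mink mink_add_left mink_smul_left mink_add_right
    mink_smul_right).toContinuousBilinearMap

@[simp] theorem minkL_apply (x y : R51) : minkL x y = mink x y := rfl

theorem eq_zero_of_mink (v : R51) (h : ∀ w, mink v w = 0) : v = 0 := by
  ext i
  have := h (Pi.single i 1)
  fin_cases i <;> simpa [mink] using this

/-- The orthogonal complement of a timelike vector is positive definite. This makes the induced
metric Riemannian and lets orthogonality arguments in the tangent plane force vectors to vanish. -/
theorem mink_self_pos {q v : R51} (hq : q ∈ H4) (h : mink v q = 0) (hv : v ≠ 0) :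
    0 < mink v v := by
  obtain ⟨h1, h2⟩ := hq
  simp only [mink] at *
  by_contra! hneg
  have a0 := mul_self_nonneg (v 0)
  have a1 := mul_self_nonneg (v 1)
  have a2 := mul_self_nonneg (v 2)
  have a3 := mul_self_nonneg (v 3)
  set S := v 0 * v 0 + v 1 * v 1 + v 2 * v 2 + v 3 * v 3 with hS
  have hS0 : 0 ≤ S := by linarith
  have hCS : (v 0 * q 0 + v 1 * q 1 + v 2 * q 2 + v 3 * q 3) ^ 2
      ≤ S * (q 0 * q 0 + q 1 * q 1 + q 2 * q 2 + q 3 * q 3) := by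
    nlinarith [sq_nonneg (v 0 * q 1 - v 1 * q 0), sq_nonneg (v 0 * q 2 - v 2 * q 0),
      sq_nonneg (v 0 * q 3 - v 3 * q 0), sq_nonneg (v 1 * q 2 - v 2 * q 1),
      sq_nonneg (v 1 * q 3 - v 3 * q 1), sq_nonneg (v 2 * q 3 - v 3 * q 2)]
  have e1 : v 0 * q 0 + v 1 * q 1 + v 2 * q 2 + v 3 * q 3 = v 4 * q 4 := by linarith
  have e2 : q 0 * q 0 + q 1 * q 1 + q 2 * q 2 + q 3 * q 3 = q 4 * q 4 - 1 := by linarith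
  rw [e1, e2] at hCS
  -- If $S\le (v^5)^2$, Cauchy–Schwarz for the spatial parts gives $S(q^5)^2\le (v^5q^5)^2\le
  -- S((q^5)^2-1)$, hence $S\le0$.
  have hSz : S = 0 := by nlinarith [mul_nonneg (sub_nonneg.2 hneg) (mul_self_nonneg (q 4))]
  have hv4 : v 4 = 0 := by
    have : (v 4 * q 4) ^ 2 ≤ 0 := by simpa [hSz] using hCS
    have := pow_eq_zero_iff (two_ne_zero) |>.1 (le_antisymm this (sq_nonneg _))
    rcases mul_eq_zero.1 this with h | h
    · exact h
    · exact absurd h h2.ne'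
  apply hv
  ext i
  fin_cases i
  · exact mul_self_eq_zero.1 (show v 0 * v 0 = 0 by linarith)
  · exact mul_self_eq_zero.1 (show v 1 * v 1 = 0 by linarith)
  · exact mul_self_eq_zero.1 (show v 2 * v 2 = 0 by linarith)
  · exact mul_self_eq_zero.1 (show v 3 * v 3 = 0 by linarith)
  · exact hv4

/-- A Minkowski-orthonormal frame of `ℝ⁵₁` whose timelike member is `q`. -/
structure IsFrame (q e₁ e₂ e₃ e₄ : R51) : Prop where
  qq : mink q q = -1
  q1 : mink q e₁ = 0
  q2 : mink q e₂ = 0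
  q3 : mink q e₃ = 0
  q4 : mink q e₄ = 0
  h11 : mink e₁ e₁ = 1
  h12 : mink e₁ e₂ = 0
  h13 : mink e₁ e₃ = 0
  h14 : mink e₁ e₄ = 0
  h22 : mink e₂ e₂ = 1
  h23 : mink e₂ e₃ = 0
  h24 : mink e₂ e₄ = 0
  h33 : mink e₃ e₃ = 1
  h34 : mink e₃ e₄ = 0
  h44 : mink e₄ e₄ = 1

namespace IsFrame

variable {q e₁ e₂ e₃ e₄ : R51}

theorem linearIndependent (h : IsFrame q e₁ e₂ e₃ e₄) :
    LinearIndependent ℝ ![q, e₁, e₂, e₃, e₄] := by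
  rw [Fintype.linearIndependent_iff]
  intro g hg
  simp only [Fin.sum_univ_five, Matrix.cons_val] at hg
  have t := fun w => congrArg (fun v => mink v w) hg
  have tq := t q
  have t1 := t e₁
  have t2 := t e₂
  have t3 := t e₃
  have t4 := t e₄
  simp only [mink_add_left, mink_smul_left, mink_zero_left, mink_comm e₁ q, mink_comm e₂ q,
    mink_comm e₃ q, mink_comm e₄ q, mink_comm e₂ e₁, mink_comm e₃ e₁, mink_comm e₄ e₁,
    mink_comm e₃ e₂, mink_comm e₄ e₂, mink_comm e₄ e₃, h.qq, h.q1, h.q2, h.q3, h.q4, h.h11, h.h12,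
    h.h13, h.h14, h.h22, h.h23, h.h24, h.h33, h.h34, h.h44] at tq t1 t2 t3 t4
  intro i
  fin_cases i <;> simp <;> linarith

theorem eq_zero (h : IsFrame q e₁ e₂ e₃ e₄) {v : R51} (vq : mink v q = 0) (v1 : mink v e₁ = 0)
    (v2 : mink v e₂ = 0)
    (v3 : mink v e₃ = 0) (v4 : mink v e₄ = 0) : v = 0 := by
  have hspan := h.linearIndependent.span_eq_top_of_card_eq_finrank (by simp)
  refine eq_zero_of_mink v fun w => ?_
  have hw : w ∈ Submodule.span ℝ (Set.range ![q, e₁, e₂, e₃, e₄]) := by rw [hspan]; trivial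
  induction hw using Submodule.span_induction with
  | mem x hx =>
    obtain ⟨i, rfl⟩ := hx
    fin_cases i <;> simpa
  | zero => simp
  | add x y _ _ hx hy => simp [hx, hy]
  | smul a x _ hx => simp [hx]

/-- The sign in the first hypothesis reflects that $q$ is timelike: its coefficient is minus the
scalar product with $q$. -/
theorem eq_comb (h : IsFrame q e₁ e₂ e₃ e₄) {v : R51} {cq c1 c2 c3 c4 : ℝ}
    (vq : mink v q = -cq) (v1 : mink v e₁ = c1)
    (v2 : mink v e₂ = c2) (v3 : mink v e₃ = c3) (v4 : mink v e₄ = c4) :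
    v = cq • q + c1 • e₁ + c2 • e₂ + c3 • e₃ + c4 • e₄ := by
  rw [← sub_eq_zero]
  apply h.eq_zero <;>
  simp only [mink_sub_left, mink_add_left, mink_smul_left, mink_comm e₁ q, mink_comm e₂ q,
    mink_comm e₃ q, mink_comm e₄ q, mink_comm e₂ e₁, mink_comm e₃ e₁, mink_comm e₄ e₁,
    mink_comm e₃ e₂, mink_comm e₄ e₂, mink_comm e₄ e₃, h.qq, h.q1, h.q2, h.q3, h.q4, h.h11, h.h12,
    h.h13, h.h14, h.h22, h.h23, h.h24, h.h33, h.h34, h.h44, vq, v1, v2, v3, v4] <;> ring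

end IsFrame

/-! ### Differentiation of the Minkowski form -/

section Deriv

variable {G : Type*} [NormedAddCommGroup G] [NormedSpace ℝ G] {F K : G → R51} {x : G}

theorem contDiffOn_mink {n : WithTop ℕ∞} {s : Set G} (hF : ContDiffOn ℝ n F s)
    (hK : ContDiffOn ℝ n K s) : ContDiffOn ℝ n (fun y => mink (F y) (K y)) s :=
  minkL.isBoundedBilinearMap.contDiff.comp_contDiffOn (hF.prodMk hK)

theorem hasFDerivAt_mink {F' K' : G →L[ℝ] R51} (hF : HasFDerivAt F F' x)
    (hK : HasFDerivAt K K' x) :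
    HasFDerivAt (fun y => mink (F y) (K y))
      (minkL.precompR G (F x) K' + minkL.precompL G F' (K x)) x :=
  minkL.hasFDerivAt_of_bilinear hF hK

theorem fderiv_mink (hF : DifferentiableAt ℝ F x) (hK : DifferentiableAt ℝ K x) (v : G) :
    fderiv ℝ (fun y => mink (F y) (K y)) x v =
      mink (fderiv ℝ F x v) (K x) + mink (F x) (fderiv ℝ K x v) := by
  rw [(hasFDerivAt_mink hF.hasFDerivAt hK.hasFDerivAt).fderiv]
  simp [add_comm]

end Deriv

/-! ### Directional derivatives along vector fields in the parameter plane -/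

section Dir

variable {G : Type*} [NormedAddCommGroup G] [NormedSpace ℝ G]

/-- The derivative of `F` along the vector field `a`. -/
noncomputable def dir (a : E2 → E2) (F : E2 → G) (x : E2) : G := fderiv ℝ F x (a x)

variable {U : Set E2} {a b : E2 → E2} {x : E2}

theorem differentiableAt_of_smooth (hU : IsOpen U) {F : E2 → G} (hF : ContDiffOn ℝ ∞ F U)
    (hx : x ∈ U) : DifferentiableAt ℝ F x :=
  (hF.contDiffAt (hU.mem_nhds hx)).differentiableAt (by simp)

theorem smooth_dir (hU : IsOpen U) {F : E2 → G} (hF : ContDiffOn ℝ ∞ F U)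
    (ha : ContDiffOn ℝ ∞ a U) : ContDiffOn ℝ ∞ (dir a F) U :=
  (hF.fderiv_of_isOpen hU (by simp)).clm_apply ha

theorem dir_congr (hU : IsOpen U) {F K : E2 → G} (h : Set.EqOn F K U) (hx : x ∈ U) :
    dir a F x = dir a K x := by
  simp only [dir]
  rw [(h.eventuallyEq_of_mem (hU.mem_nhds hx)).fderiv_eq]

theorem dir_const_on (hU : IsOpen U) {F : E2 → G} {c : G} (h : ∀ y ∈ U, F y = c) (hx : x ∈ U) :
    dir a F x = 0 := by
  rw [dir_congr hU (K := fun _ => c) h hx]; simp [dir]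

theorem dir_mink (hU : IsOpen U) {F K : E2 → R51} (hF : ContDiffOn ℝ ∞ F U)
    (hK : ContDiffOn ℝ ∞ K U) (hx : x ∈ U) :
    dir a (fun y => mink (F y) (K y)) x = mink (dir a F x) (K x) + mink (F x) (dir a K x) :=
  fderiv_mink (differentiableAt_of_smooth hU hF hx) (differentiableAt_of_smooth hU hK hx) _

theorem dir_mul (hU : IsOpen U) {f g : E2 → ℝ} (hf : ContDiffOn ℝ ∞ f U)
    (hg : ContDiffOn ℝ ∞ g U) (hx : x ∈ U) :
    dir a (fun y => f y * g y) x = dir a f x * g x + f x * dir a g x := by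
  simp only [dir]
  rw [fderiv_fun_mul (differentiableAt_of_smooth hU hf hx) (differentiableAt_of_smooth hU hg hx)]
  simp; ring

theorem dir_smul (hU : IsOpen U) {f : E2 → ℝ} {F : E2 → G} (hf : ContDiffOn ℝ ∞ f U)
    (hF : ContDiffOn ℝ ∞ F U) (hx : x ∈ U) :
    dir a (fun y => f y • F y) x = dir a f x • F x + f x • dir a F x := by
  simp only [dir]
  rw [fderiv_fun_smul (differentiableAt_of_smooth hU hf hx) (differentiableAt_of_smooth hU hF hx)]
  simp [add_comm]

theorem dir_const_mul (c : ℝ) (f : E2 → ℝ) : dir a (fun y => c * f y) x = c * dir a f x := by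
  simp only [dir]
  rw [show (fun y => c * f y) = c • f from rfl, fderiv_const_smul_field]
  simp

theorem dir_neg (f : E2 → ℝ) : dir a (fun y => -f y) x = -dir a f x := by
  simp only [dir]
  rw [fderiv_fun_neg]; simp

theorem dir_add (hU : IsOpen U) {f g : E2 → ℝ} (hf : ContDiffOn ℝ ∞ f U)
    (hg : ContDiffOn ℝ ∞ g U) (hx : x ∈ U) :
    dir a (fun y => f y + g y) x = dir a f x + dir a g x := by
  simp only [dir]
  rw [fderiv_fun_add (differentiableAt_of_smooth hU hf hx) (differentiableAt_of_smooth hU hg hx)]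
  simp

theorem dir_dir (hU : IsOpen U) {F : E2 → G} (hF : ContDiffOn ℝ ∞ F U)
    (hb : ContDiffOn ℝ ∞ b U) (hx : x ∈ U) :
    dir a (dir b F) x = fderiv ℝ (fderiv ℝ F) x (a x) (b x) + fderiv ℝ F x (dir a b x) := by
  have h1 : DifferentiableAt ℝ (fderiv ℝ F) x :=
    differentiableAt_of_smooth hU (hF.fderiv_of_isOpen hU (by simp)) hx
  have h2 := differentiableAt_of_smooth hU hb hx
  have := (h1.hasFDerivAt.clm_apply h2.hasFDerivAt).fderiv
  simp only [dir]
  change fderiv ℝ (fun y => fderiv ℝ F y (b y)) x (a x) = _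
  rw [this]
  simp [add_comm]

/-- Second derivatives are symmetric, so only the derivative along the Lie bracket of the two fields
survives. Flatness of $\mathbb R^5_1$ enters the structure equations here. -/
theorem dir_dir_sub (hU : IsOpen U) {F : E2 → G} (hF : ContDiffOn ℝ ∞ F U)
    (ha : ContDiffOn ℝ ∞ a U) (hb : ContDiffOn ℝ ∞ b U) (hx : x ∈ U) :
    dir a (dir b F) x - dir b (dir a F) x = fderiv ℝ F x (dir a b x - dir b a x) := by
  have hs : IsSymmSndFDerivAt ℝ F x :=
    (hF.contDiffAt (hU.mem_nhds hx)).isSymmSndFDerivAt (by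
      rw [minSmoothness_of_isRCLikeNormedField]; exact WithTop.coe_le_coe.2 le_top)
  rw [dir_dir hU hF hb hx, dir_dir hU hF ha hx, hs (a x) (b x), map_sub]
  abel

end Dir

/-! ### Moving frames -/

/-- An orthonormal frame `e₁, …, e₄` adapted to the surface `X` over the parameter domain `U`, with
`e₁ = dX a`, `e₂ = dX b`. -/
structure AdaptedFrame (U : Set E2) (X e₁ e₂ e₃ e₄ : E2 → R51) (a b : E2 → E2) : Prop where
  isOpen : IsOpen U
  sX : ContDiffOn ℝ ∞ X U
  s1 : ContDiffOn ℝ ∞ e₁ U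
  s2 : ContDiffOn ℝ ∞ e₂ U
  s3 : ContDiffOn ℝ ∞ e₃ U
  s4 : ContDiffOn ℝ ∞ e₄ U
  sa : ContDiffOn ℝ ∞ a U
  sb : ContDiffOn ℝ ∞ b U
  frame : ∀ x ∈ U, IsFrame (X x) (e₁ x) (e₂ x) (e₃ x) (e₄ x)
  dXa : ∀ x ∈ U, fderiv ℝ X x (a x) = e₁ x
  dXb : ∀ x ∈ U, fderiv ℝ X x (b x) = e₂ x

/-- Two vectors of the plane with orthonormal images form a basis. -/
theorem exists_eq_smul_add_smul {L : E2 →L[ℝ] R51} {u v : E2} (huu : mink (L u) (L u) = 1)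
    (huv : mink (L u) (L v) = 0) (hvv : mink (L v) (L v) = 1) (w : E2) :
    ∃ α β : ℝ, w = α • u + β • v := by
  have hli : LinearIndependent ℝ ![u, v] := by
    rw [LinearIndependent.pair_iff]
    intro s t hst
    have h := congrArg L hst
    simp only [map_add, map_smul, map_zero] at h
    have h1 := congrArg (fun z => mink z (L u)) h
    have h2 := congrArg (fun z => mink z (L v)) h
    simp [mink_comm (L v) (L u), huu, huv, hvv] at h1 h2
    exact ⟨h1, h2⟩
  have hspan := hli.span_eq_top_of_card_eq_finrank (by simp)
  have hw : w ∈ Submodule.span ℝ (Set.range ![u, v]) := by rw [hspan]; trivial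
  rw [Matrix.range_cons, Matrix.range_cons, Matrix.range_empty, Set.union_empty,
    Set.singleton_union, Submodule.mem_span_pair] at hw
  obtain ⟨α, β, h⟩ := hw
  exact ⟨α, β, h.symm⟩

namespace AdaptedFrame

variable {U : Set E2} {X e₁ e₂ e₃ e₄ : E2 → R51} {a b : E2 → E2} {x : E2}

theorem exists_comb (A : AdaptedFrame U X e₁ e₂ e₃ e₄ a b) (hx : x ∈ U) (w : E2) :
    ∃ α β : ℝ, w = α • a x + β • b x :=
  exists_eq_smul_add_smul (L := fderiv ℝ X x) (by rw [A.dXa x hx, (A.frame x hx).h11])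
    (by rw [A.dXa x hx, A.dXb x hx, (A.frame x hx).h12])
    (by rw [A.dXb x hx, (A.frame x hx).h22]) w

/-- Derivatives of a constant scalar product. -/
theorem dir_anti (A : AdaptedFrame U X e₁ e₂ e₃ e₄ a b) {F K : E2 → R51}
    (hF : ContDiffOn ℝ ∞ F U) (hK : ContDiffOn ℝ ∞ K U) {c : ℝ} (h : ∀ y ∈ U, mink (F y) (K y) = c)
    (v : E2 → E2) (hx : x ∈ U) : mink (dir v F x) (K x) = -mink (dir v K x) (F x) := by
  have h1 := dir_const_on (a := v) A.isOpen h hx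
  rw [dir_mink A.isOpen hF hK hx] at h1
  rw [mink_comm (dir v K x)]
  linarith

/-- Torsion-freeness. Applying the commutator to $X$ itself shows that $dX$ of the bracket is
$D_ae_2-D_be_1$; since this is tangent, pairing it with $e_1$ and $e_2$ determines its coordinates.
-/
theorem bracket (A : AdaptedFrame U X e₁ e₂ e₃ e₄ a b) (hx : x ∈ U) :
    dir a b x - dir b a x =
      (-mink (dir a e₁ x) (e₂ x)) • a x + (-mink (dir b e₁ x) (e₂ x)) • b x ∧
    dir a e₂ x - dir b e₁ x =
      (-mink (dir a e₁ x) (e₂ x)) • e₁ x + (-mink (dir b e₁ x) (e₂ x)) • e₂ x := by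
  obtain ⟨α, β, h⟩ := A.exists_comb hx (dir a b x - dir b a x)
  have h2 := dir_dir_sub A.isOpen A.sX A.sa A.sb hx
  rw [dir_congr A.isOpen (F := dir b X) (K := e₂) (fun y hy => A.dXb y hy) hx,
    dir_congr A.isOpen (F := dir a X) (K := e₁) (fun y hy => A.dXa y hy) hx, h, map_add,
      map_smul, map_smul,
    A.dXa x hx, A.dXb x hx] at h2
  have F := A.frame x hx
  have h11 := A.dir_anti A.s1 A.s1 (c := 1) (fun y hy => (A.frame y hy).h11) b hx
  have h22 := A.dir_anti A.s2 A.s2 (c := 1) (fun y hy => (A.frame y hy).h22) a hx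
  have h12 := A.dir_anti A.s1 A.s2 (c := 0) (fun y hy => (A.frame y hy).h12) a hx
  have t1 := congrArg (fun z => mink z (e₁ x)) h2
  have t2 := congrArg (fun z => mink z (e₂ x)) h2
  simp only [mink_sub_left, mink_add_left, mink_smul_left, F.h11, F.h12, mink_comm (e₂ x) (e₁ x),
    F.h22] at t1 t2
  have hα : α = -mink (dir a e₁ x) (e₂ x) := by linarith
  have hβ : β = -mink (dir b e₁ x) (e₂ x) := by linarith
  rw [← hα, ← hβ]
  exact ⟨h, h2⟩

theorem dir_comm (A : AdaptedFrame U X e₁ e₂ e₃ e₄ a b) {G : Type*} [NormedAddCommGroup G]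
    [NormedSpace ℝ G] {F : E2 → G} (hF : ContDiffOn ℝ ∞ F U) (hx : x ∈ U) :
    dir a (dir b F) x - dir b (dir a F) x =
      (-mink (dir a e₁ x) (e₂ x)) • dir a F x + (-mink (dir b e₁ x) (e₂ x)) • dir b F x := by
  rw [dir_dir_sub A.isOpen hF A.sa A.sb hx, (A.bracket hx).1, map_add, map_smul, map_smul]
  rfl

/-- The structure equation for the pair `F, K`. -/
theorem structure_eq (A : AdaptedFrame U X e₁ e₂ e₃ e₄ a b) {F K : E2 → R51}
    (hF : ContDiffOn ℝ ∞ F U) (hK : ContDiffOn ℝ ∞ K U) (hx : x ∈ U) :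
    dir a (fun y => mink (dir b F y) (K y)) x - dir b (fun y => mink (dir a F y) (K y)) x =
      mink (dir b F x) (dir a K x) - mink (dir a F x) (dir b K x)
        - mink (dir a e₁ x) (e₂ x) * mink (dir a F x) (K x)
        - mink (dir b e₁ x) (e₂ x) * mink (dir b F x) (K x) := by
  have hU := A.isOpen
  rw [dir_mink hU (smooth_dir hU hF A.sb) hK hx, dir_mink hU (smooth_dir hU hF A.sa) hK hx]
  -- With $(F,K)=(e_1,e_2)$ this is used as the Gauss equation, with $F\in\{e_3,e_4\}$ and
  -- $K\in\{e_1,e_2\}$ as Codazzi, and with $(e_3,e_4)$ as Ricci.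
  have h := congrArg (fun z => mink z (K x)) (A.dir_comm hF hx)
  simp only [mink_sub_left, mink_add_left, mink_smul_left] at h
  linarith

/-- The structure equations of an adapted frame whose third member is parallel in the normal
bundle. -/
theorem frame_eqs (A : AdaptedFrame U X e₁ e₂ e₃ e₄ a b)
    (hpar : ∀ y ∈ U, ∀ v, mink (fderiv ℝ e₃ y v) (e₄ y) = 0) (hx : x ∈ U) :
    mink (dir a e₂ x) (e₃ x) = mink (dir b e₁ x) (e₃ x) ∧
    mink (dir a e₂ x) (e₄ x) = mink (dir b e₁ x) (e₄ x) ∧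
    dir a e₁ x = X x + mink (dir a e₁ x) (e₂ x) • e₂ x + mink (dir a e₁ x) (e₃ x) • e₃ x
      + mink (dir a e₁ x) (e₄ x) • e₄ x ∧
    dir a e₂ x = -mink (dir a e₁ x) (e₂ x) • e₁ x + mink (dir b e₁ x) (e₃ x) • e₃ x
      + mink (dir b e₁ x) (e₄ x) • e₄ x ∧
    dir a e₃ x = -mink (dir a e₁ x) (e₃ x) • e₁ x + -mink (dir b e₁ x) (e₃ x) • e₂ x ∧
    dir a e₄ x = -mink (dir a e₁ x) (e₄ x) • e₁ x + -mink (dir b e₁ x) (e₄ x) • e₂ x ∧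
    dir b e₁ x = mink (dir b e₁ x) (e₂ x) • e₂ x + mink (dir b e₁ x) (e₃ x) • e₃ x
      + mink (dir b e₁ x) (e₄ x) • e₄ x ∧
    dir b e₂ x = X x + -mink (dir b e₁ x) (e₂ x) • e₁ x + mink (dir b e₂ x) (e₃ x) • e₃ x
      + mink (dir b e₂ x) (e₄ x) • e₄ x ∧
    dir b e₃ x = -mink (dir b e₁ x) (e₃ x) • e₁ x + -mink (dir b e₂ x) (e₃ x) • e₂ x ∧
    dir b e₄ x = -mink (dir b e₁ x) (e₄ x) • e₁ x + -mink (dir b e₂ x) (e₄ x) • e₂ x := by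
  have F := A.frame x hx
  have Xa : dir a X x = e₁ x := A.dXa x hx
  have Xb : dir b X x = e₂ x := A.dXb x hx
  have hb := (A.bracket hx).2
  have b3 := congrArg (fun z => mink z (e₃ x)) hb
  have b4 := congrArg (fun z => mink z (e₄ x)) hb
  simp only [mink_sub_left, mink_add_left, mink_smul_left, F.h13, F.h14, F.h23, F.h24] at b3 b4
  -- The bracket is tangent, so its normal components vanish; this is the symmetry of the second
  -- fundamental form.
  have b3' : mink (dir a e₂ x) (e₃ x) = mink (dir b e₁ x) (e₃ x) := by linarith
  have b4' : mink (dir a e₂ x) (e₄ x) = mink (dir b e₁ x) (e₄ x) := by linarith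
  -- The scalar products of frame members are constant, so the connection matrix is skew. Every
  -- entry is thereby reduced to one of the named coefficients, and the position vector enters only
  -- through $\langle De_i,X\rangle=-\langle e_i,DX\rangle$.
  have q1 := fun v => A.dir_anti A.s1 A.sX (c := 0)
    (fun y hy => by rw [mink_comm]; exact (A.frame y hy).q1) v hx
  have q2 := fun v => A.dir_anti A.s2 A.sX (c := 0)
    (fun y hy => by rw [mink_comm]; exact (A.frame y hy).q2) v hx
  have q3 := fun v => A.dir_anti A.s3 A.sX (c := 0)
    (fun y hy => by rw [mink_comm]; exact (A.frame y hy).q3) v hx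
  have q4 := fun v => A.dir_anti A.s4 A.sX (c := 0)
    (fun y hy => by rw [mink_comm]; exact (A.frame y hy).q4) v hx
  have h11 := fun v => A.dir_anti A.s1 A.s1 (c := 1) (fun y hy => (A.frame y hy).h11) v hx
  have h12 := fun v => A.dir_anti A.s1 A.s2 (c := 0) (fun y hy => (A.frame y hy).h12) v hx
  have h13 := fun v => A.dir_anti A.s1 A.s3 (c := 0) (fun y hy => (A.frame y hy).h13) v hx
  have h14 := fun v => A.dir_anti A.s1 A.s4 (c := 0) (fun y hy => (A.frame y hy).h14) v hx
  have h22 := fun v => A.dir_anti A.s2 A.s2 (c := 1) (fun y hy => (A.frame y hy).h22) v hx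
  have h23 := fun v => A.dir_anti A.s2 A.s3 (c := 0) (fun y hy => (A.frame y hy).h23) v hx
  have h24 := fun v => A.dir_anti A.s2 A.s4 (c := 0) (fun y hy => (A.frame y hy).h24) v hx
  have h33 := fun v => A.dir_anti A.s3 A.s3 (c := 1) (fun y hy => (A.frame y hy).h33) v hx
  have h34 := fun v => A.dir_anti A.s3 A.s4 (c := 0) (fun y hy => (A.frame y hy).h34) v hx
  have h44 := fun v => A.dir_anti A.s4 A.s4 (c := 1) (fun y hy => (A.frame y hy).h44) v hx
  have pa : ∀ v, mink (dir v e₃ x) (e₄ x) = 0 := fun v => hpar x hx _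
  have c21 := mink_comm (e₂ x) (e₁ x)
  refine ⟨b3', b4', ?_, ?_, ?_, ?_, ?_, ?_, ?_, ?_⟩
  · refine (F.eq_comb (cq := 1) (c1 := 0) ?_ ?_ rfl rfl rfl).trans (by module)
    · rw [q1 a, Xa, F.h11]
    · linarith [h11 a]
  · refine (F.eq_comb (cq := 0) (c1 := -mink (dir a e₁ x) (e₂ x))
      (c2 := 0) ?_ ?_ ?_ b3' b4').trans (by module)
    · rw [q2 a, Xa, F.h12]
    · linarith [h12 a]
    · linarith [h22 a]
  · refine (F.eq_comb (cq := 0) (c1 := -mink (dir a e₁ x) (e₃ x)) (c2 := -mink (dir b e₁ x) (e₃ x))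
      (c3 := 0) (c4 := 0) ?_ ?_ ?_ ?_ (pa a)).trans (by module)
    · rw [q3 a, Xa, F.h13]
    · linarith [h13 a]
    · linarith [h23 a]
    · linarith [h33 a]
  · refine (F.eq_comb (cq := 0) (c1 := -mink (dir a e₁ x) (e₄ x)) (c2 := -mink (dir b e₁ x) (e₄ x))
      (c3 := 0) (c4 := 0) ?_ ?_ ?_ ?_ ?_).trans (by module)
    · rw [q4 a, Xa, F.h14]
    · linarith [h14 a]
    · linarith [h24 a]
    · linarith [h34 a, pa a]
    · linarith [h44 a]
  · refine (F.eq_comb (cq := 0) (c1 := 0) ?_ ?_ rfl rfl rfl).trans (by module)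
    · rw [q1 b, Xb, c21, F.h12]
    · linarith [h11 b]
  · refine (F.eq_comb (cq := 1) (c1 := -mink (dir b e₁ x) (e₂ x))
      (c2 := 0) ?_ ?_ ?_ rfl rfl).trans (by module)
    · rw [q2 b, Xb, F.h22]
    · linarith [h12 b]
    · linarith [h22 b]
  · refine (F.eq_comb (cq := 0) (c1 := -mink (dir b e₁ x) (e₃ x)) (c2 := -mink (dir b e₂ x) (e₃ x))
      (c3 := 0) (c4 := 0) ?_ ?_ ?_ ?_ (pa b)).trans (by module)
    · rw [q3 b, Xb, F.h23]
    · linarith [h13 b]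
    · linarith [h23 b]
    · linarith [h33 b]
  · refine (F.eq_comb (cq := 0) (c1 := -mink (dir b e₁ x) (e₄ x)) (c2 := -mink (dir b e₂ x) (e₄ x))
      (c3 := 0) (c4 := 0) ?_ ?_ ?_ ?_ ?_).trans (by module)
    · rw [q4 b, Xb, F.h24]
    · linarith [h14 b]
    · linarith [h24 b]
    · linarith [h34 b, pa b]
    · linarith [h44 b]

end AdaptedFrame

/-! ### Biconservativity in a moving frame: the shape operator of the mean curvature direction -/

namespace AdaptedFrame

variable {U : Set E2} {X e₁ e₂ e₃ e₄ : E2 → R51} {a b : E2 → E2} {f : E2 → ℝ} {x : E2}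

/-- The data of a PNMC biconservative surface with respect to an adapted frame. -/
structure IsPNMC (U : Set E2) (X e₁ e₂ e₃ e₄ : E2 → R51) (a b : E2 → E2) (f : E2 → ℝ) : Prop
    extends AdaptedFrame U X e₁ e₂ e₃ e₄ a b where
  sf : ContDiffOn ℝ ∞ f U
  fpos : ∀ x ∈ U, 0 < f x
  daf : ∀ x ∈ U, 0 < dir a f x
  dbf : ∀ x ∈ U, dir b f x = 0
  par : ∀ x ∈ U, ∀ v, mink (fderiv ℝ e₃ x v) (e₄ x) = 0
  mean3 : ∀ x ∈ U, mink (dir a e₁ x + dir b e₂ x) (e₃ x) = 2 * f x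
  mean4 : ∀ x ∈ U, mink (dir a e₁ x + dir b e₂ x) (e₄ x) = 0
  -- Pairing $\operatorname{trace}(DD-D_\nabla)\tau$, with $\tau=2fe_3$, against $e_1$ and $e_2$:
  -- the bracketed correction differentiates $\tau$ along
  -- $\nabla_{e_1}e_1+\nabla_{e_2}e_2=\omega_1e_2-\omega_2e_1$, where $\omega_1=\langle
  -- D_ae_1,e_2\rangle$ and $\omega_2=\langle D_be_1,e_2\rangle$. The curvature term and the
  -- projections onto $T\mathbb H^4$ have no tangential effect.
  bi1 : ∀ x ∈ U, mink (dir a (dir a fun y => (2 * f y) • e₃ y) x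
      + dir b (dir b fun y => (2 * f y) • e₃ y) x
      - (mink (dir a e₁ x) (e₂ x) • dir b (fun y => (2 * f y) • e₃ y) x
        - mink (dir b e₁ x) (e₂ x) • dir a (fun y => (2 * f y) • e₃ y) x)) (e₁ x) = 0
  bi2 : ∀ x ∈ U, mink (dir a (dir a fun y => (2 * f y) • e₃ y) x
      + dir b (dir b fun y => (2 * f y) • e₃ y) x
      - (mink (dir a e₁ x) (e₂ x) • dir b (fun y => (2 * f y) • e₃ y) x
        - mink (dir b e₁ x) (e₂ x) • dir a (fun y => (2 * f y) • e₃ y) x)) (e₂ x) = 0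

namespace IsPNMC

/-- The biconservativity equation `A₃ (grad f) = -f grad f`. -/
theorem shape_three (A : IsPNMC U X e₁ e₂ e₃ e₄ a b f) (hx : x ∈ U) :
    mink (dir a e₁ x) (e₃ x) = -f x ∧ mink (dir b e₁ x) (e₃ x) = 0 ∧
      mink (dir b e₂ x) (e₃ x) = 3 * f x := by
  have hU := A.isOpen
  have F := A.frame x hx
  have E := fun y (hy : y ∈ U) => A.frame_eqs A.par hy
  -- The entries of $A_3$ and the connection coefficients become opaque functions, so that they can
  -- be differentiated and treated as atoms by the final linear algebra.
  obtain ⟨h11, h11d⟩ : ∃ h : E2 → ℝ, h = fun y => mink (dir a e₁ y) (e₃ y) := ⟨_, rfl⟩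
  obtain ⟨h12, h12d⟩ : ∃ h : E2 → ℝ, h = fun y => mink (dir b e₁ y) (e₃ y) := ⟨_, rfl⟩
  obtain ⟨h22, h22d⟩ : ∃ h : E2 → ℝ, h = fun y => mink (dir b e₂ y) (e₃ y) := ⟨_, rfl⟩
  obtain ⟨w1, w1d⟩ : ∃ h : E2 → ℝ, h = fun y => mink (dir a e₁ y) (e₂ y) := ⟨_, rfl⟩
  obtain ⟨w2, w2d⟩ : ∃ h : E2 → ℝ, h = fun y => mink (dir b e₁ y) (e₂ y) := ⟨_, rfl⟩
  have h11e : ∀ y, mink (dir a e₁ y) (e₃ y) = h11 y := fun y => by rw [h11d]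
  have h12e : ∀ y, mink (dir b e₁ y) (e₃ y) = h12 y := fun y => by rw [h12d]
  have h22e : ∀ y, mink (dir b e₂ y) (e₃ y) = h22 y := fun y => by rw [h22d]
  have w1e : ∀ y, mink (dir a e₁ y) (e₂ y) = w1 y := fun y => by rw [w1d]
  have w2e : ∀ y, mink (dir b e₁ y) (e₂ y) = w2 y := fun y => by rw [w2d]
  simp only [h11e, h12e, h22e, w1e, w2e] at E
  obtain ⟨-, -, Ea1, Ea2, Ea3, -, Eb1, Eb2, Eb3, -⟩ := E x hx
  have sa1 := smooth_dir hU A.s1 A.sa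
  have sb1 := smooth_dir hU A.s1 A.sb
  have sb2 := smooth_dir hU A.s2 A.sb
  have sh11 : ContDiffOn ℝ ∞ h11 U := h11d ▸ contDiffOn_mink sa1 A.s3
  have sh12 : ContDiffOn ℝ ∞ h12 U := h12d ▸ contDiffOn_mink sb1 A.s3
  have sh22 : ContDiffOn ℝ ∞ h22 U := h22d ▸ contDiffOn_mink sb2 A.s3
  have s2f : ContDiffOn ℝ ∞ (fun y => 2 * f y) U := contDiffOn_const.mul A.sf
  have c21 : mink (e₂ x) (e₁ x) = 0 := by rw [mink_comm, F.h12]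
  have c31 : mink (e₃ x) (e₁ x) = 0 := by rw [mink_comm, F.h13]
  have c32 : mink (e₃ x) (e₂ x) = 0 := by rw [mink_comm, F.h23]
  -- the trace of `A₃`
  have hsum : ∀ y ∈ U, h11 y + h22 y = 2 * f y := fun y hy => by
    rw [← A.mean3 y hy, mink_add_left, h11e, h22e]
  have hda : dir a h11 x + dir a h22 x = 2 * dir a f x := by
    rw [← dir_add hU sh11 sh22 hx, dir_congr hU hsum hx, dir_const_mul]
  have hdb : dir b h11 x + dir b h22 x = 0 := by
    rw [← dir_add hU sh11 sh22 hx, dir_congr hU hsum hx, dir_const_mul, A.dbf x hx, mul_zero]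
  -- the Codazzi equations for `e₃`
  have P31a : ∀ y ∈ U, mink (dir a e₃ y) (e₁ y) = -h11 y := fun y hy => by
    have F := A.frame y hy
    rw [(E y hy).2.2.2.2.1]; simp [F.h11, mink_comm (e₂ y) (e₁ y), F.h12]
  have P32a : ∀ y ∈ U, mink (dir a e₃ y) (e₂ y) = -h12 y := fun y hy => by
    have F := A.frame y hy
    rw [(E y hy).2.2.2.2.1]; simp [F.h22, F.h12]
  have P31b : ∀ y ∈ U, mink (dir b e₃ y) (e₁ y) = -h12 y := fun y hy => by
    have F := A.frame y hy
    rw [(E y hy).2.2.2.2.2.2.2.2.1]; simp [F.h11, mink_comm (e₂ y) (e₁ y), F.h12]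
  have P32b : ∀ y ∈ U, mink (dir b e₃ y) (e₂ y) = -h22 y := fun y hy => by
    have F := A.frame y hy
    rw [(E y hy).2.2.2.2.2.2.2.2.1]; simp [F.h22, F.h12]
  have C31 := A.structure_eq A.s3 A.s1 hx
  have C32 := A.structure_eq A.s3 A.s2 hx
  rw [w1e, w2e] at C31 C32
  rw [dir_congr hU P31a hx, dir_congr hU P31b hx, dir_neg, dir_neg, P31a x hx, P31b x hx,
    Ea1, Eb1, Ea3, Eb3] at C31
  rw [dir_congr hU P32a hx, dir_congr hU P32b hx, dir_neg, dir_neg, P32a x hx, P32b x hx,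
    Ea2, Eb2, Ea3, Eb3] at C32
  simp only [mink_add_left, mink_smul_left, mink_add_right, mink_smul_right, F.h11, F.h12, F.h13,
    F.h14, F.h22, F.h23, F.h24, c21, mink_comm (e₁ x) (X x), mink_comm (e₂ x) (X x), F.q1, F.q2]
    at C31 C32
  -- the biconservativity equations
  obtain ⟨V, hV⟩ : ∃ V : E2 → R51, V = fun y => (2 * f y) • e₃ y := ⟨_, rfl⟩
  have sV : ContDiffOn ℝ ∞ V U := hV ▸ s2f.smul A.s3
  have saV := smooth_dir hU sV A.sa
  have sbV := smooth_dir hU sV A.sb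
  have Va : ∀ y ∈ U, dir a V y = (2 * dir a f y) • e₃ y + (2 * f y) • dir a e₃ y := fun y hy => by
    rw [hV, dir_smul hU s2f A.s3 hy, dir_const_mul]
  have Vb : ∀ y ∈ U, dir b V y = (2 * f y) • dir b e₃ y := fun y hy => by
    rw [hV, dir_smul hU s2f A.s3 hy, dir_const_mul, A.dbf y hy]; simp
  have Va1 : ∀ y ∈ U, mink (dir a V y) (e₁ y) = (2 * f y) * (-h11 y) := fun y hy => by
    simp [Va y hy, mink_comm (e₃ y) (e₁ y), (A.frame y hy).h13, P31a y hy]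
  have Va2 : ∀ y ∈ U, mink (dir a V y) (e₂ y) = (2 * f y) * (-h12 y) := fun y hy => by
    simp [Va y hy, mink_comm (e₃ y) (e₂ y), (A.frame y hy).h23, P32a y hy]
  have Vb1 : ∀ y ∈ U, mink (dir b V y) (e₁ y) = (2 * f y) * (-h12 y) := fun y hy => by
    simp [Vb y hy, P31b y hy]
  have Vb2 : ∀ y ∈ U, mink (dir b V y) (e₂ y) = (2 * f y) * (-h22 y) := fun y hy => by
    simp [Vb y hy, P32b y hy]
  -- The product rule moves the outer derivative from $DV$ onto the known scalar products $\langle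
  -- DV,e_i\rangle$, so second derivatives of $V$ are never expanded.
  have Q1 := dir_mink (a := a) hU saV A.s1 hx
  have Q2 := dir_mink (a := b) hU sbV A.s1 hx
  have Q3 := dir_mink (a := a) hU saV A.s2 hx
  have Q4 := dir_mink (a := b) hU sbV A.s2 hx
  rw [dir_congr hU Va1 hx, dir_mul hU s2f sh11.neg hx, dir_neg, dir_const_mul, Va x hx, Ea1, Ea3]
    at Q1
  rw [dir_congr hU Vb1 hx, dir_mul hU s2f sh12.neg hx, dir_neg, dir_const_mul, Vb x hx, Eb1, Eb3,
    A.dbf x hx] at Q2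
  rw [dir_congr hU Va2 hx, dir_mul hU s2f sh12.neg hx, dir_neg, dir_const_mul, Va x hx, Ea2, Ea3]
    at Q3
  rw [dir_congr hU Vb2 hx, dir_mul hU s2f sh22.neg hx, dir_neg, dir_const_mul, Vb x hx, Eb2, Eb3,
    A.dbf x hx] at Q4
  simp only [mink_add_left, mink_smul_left, mink_add_right, mink_smul_right, F.h11, F.h12, F.h13,
    F.h14, F.h22, F.h23, F.h24, F.h33, F.h34, c21, c31, c32, mink_comm (e₁ x) (X x),
    mink_comm (e₂ x) (X x), mink_comm (e₃ x) (X x), F.q1, F.q2, F.q3] at Q1 Q2 Q3 Q4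
  have B1 := A.bi1 x hx
  have B2 := A.bi2 x hx
  rw [← hV, w1e, w2e] at B1 B2
  simp only [mink_add_left, mink_sub_left, mink_smul_left, Va1 x hx, Vb1 x hx, Va2 x hx,
    Vb2 x hx] at B1 B2
  rw [h11e, h12e, h22e]
  have f0 := A.fpos x hx
  have f1 := A.daf x hx
  -- The derivatives of the entries of $A_3$ add up to its divergence, which the Codazzi equations
  -- turn into the derivative of the trace $2f$. What remains is the pairing with $E_1$ and $E_2$ of
  -- $4(A_3\,\mathrm{grad}f+f\,\mathrm{grad}f)$.
  have R1 : (4 * dir a f x) * (h11 x + f x) = 0 := by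
    linear_combination -B1 - Q1 - Q2 - 2 * f x * C32 - 2 * f x * hda
  have R2 : (4 * dir a f x) * h12 x = 0 := by
    linear_combination -B2 - Q3 - Q4 + 2 * f x * C31 - 2 * f x * hdb
  have S1 : h11 x = -f x := by
    have := (mul_eq_zero.1 R1).resolve_left (by positivity)
    linarith
  have S2 : h12 x = 0 := (mul_eq_zero.1 R2).resolve_left (by positivity)
  exact ⟨S1, S2, by linarith [hsum x hx]⟩

end IsPNMC

end AdaptedFrame

/-! ### Ricci, Codazzi and Gauss equations -/

namespace AdaptedFrame.IsPNMC

variable {U : Set E2} {X e₁ e₂ e₃ e₄ : E2 → R51} {a b : E2 → E2} {f : E2 → ℝ} {x : E2}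

/-- The Ricci equation: `A₄` is diagonal, and trace-free. -/
theorem shape_four (A : IsPNMC U X e₁ e₂ e₃ e₄ a b f) (hx : x ∈ U) :
    mink (dir b e₁ x) (e₄ x) = 0 ∧ mink (dir b e₂ x) (e₄ x) = -mink (dir a e₁ x) (e₄ x) := by
  have hU := A.isOpen
  have F := A.frame x hx
  obtain ⟨S1, S2, S3⟩ := A.shape_three hx
  obtain ⟨-, -, Ea1, Ea2, Ea3, Ea4, Eb1, Eb2, Eb3, Eb4⟩ := A.frame_eqs A.par hx
  have hm := A.mean4 x hx
  rw [mink_add_left] at hm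
  refine ⟨?_, by linarith⟩
  have C := A.structure_eq A.s3 A.s4 hx
  have pa : ∀ v : E2 → E2, ∀ y ∈ U, mink (dir v e₃ y) (e₄ y) = 0 := fun v y hy => A.par y hy _
  rw [dir_const_on hU (pa b) hx, dir_const_on hU (pa a) hx, pa a x hx, pa b x hx, Ea3, Ea4, Eb3,
    Eb4, S1, S2, S3] at C
  simp only [mink_add_left, mink_smul_left, mink_add_right, mink_smul_right, F.h11, F.h12, F.h22,
    mink_comm (e₂ x) (e₁ x)] at C
  have f0 := A.fpos x hx
  -- The factor $4f$ is the gap between the eigenvalues $3f$ and $-f$ of $A_3$.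
  have : (4 * f x) * mink (dir b e₁ x) (e₄ x) = 0 := by linarith
  exact (mul_eq_zero.1 this).resolve_left (by positivity)

/-- The integral curves of `e₁` are geodesics. -/
theorem geodesic (A : IsPNMC U X e₁ e₂ e₃ e₄ a b f) (hx : x ∈ U) :
    mink (dir a e₁ x) (e₂ x) = 0 ∧ dir a f x = -(4 / 3) * f x * mink (dir b e₁ x) (e₂ x) := by
  have hU := A.isOpen
  have F := A.frame x hx
  obtain ⟨S1, S2, S3⟩ := A.shape_three hx
  obtain ⟨S4, S5⟩ := A.shape_four hx
  obtain ⟨-, -, Ea1, Ea2, Ea3, -, Eb1, Eb2, Eb3, -⟩ := A.frame_eqs A.par hx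
  have c21 : ∀ y ∈ U, mink (e₂ y) (e₁ y) = 0 := fun y hy => by rw [mink_comm, (A.frame y hy).h12]
  have P31a : ∀ y ∈ U, mink (dir a e₃ y) (e₁ y) = f y := fun y hy => by
    rw [(A.frame_eqs A.par hy).2.2.2.2.1]
    simp [(A.frame y hy).h11, c21 y hy, (A.shape_three hy).1]
  have P32a : ∀ y ∈ U, mink (dir a e₃ y) (e₂ y) = 0 := fun y hy => by
    rw [(A.frame_eqs A.par hy).2.2.2.2.1]
    simp [(A.frame y hy).h12, (A.shape_three hy).2.1]
  have P31b : ∀ y ∈ U, mink (dir b e₃ y) (e₁ y) = 0 := fun y hy => by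
    rw [(A.frame_eqs A.par hy).2.2.2.2.2.2.2.2.1]
    simp [c21 y hy, (A.shape_three hy).2.1]
  have P32b : ∀ y ∈ U, mink (dir b e₃ y) (e₂ y) = (-3) * f y := fun y hy => by
    rw [(A.frame_eqs A.par hy).2.2.2.2.2.2.2.2.1]
    simp [(A.frame y hy).h12, (A.frame y hy).h22, (A.shape_three hy).2.2]
  have C31 := A.structure_eq A.s3 A.s1 hx
  have C32 := A.structure_eq A.s3 A.s2 hx
  obtain ⟨w1, w1e⟩ : ∃ w, w = mink (dir a e₁ x) (e₂ x) := ⟨_, rfl⟩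
  obtain ⟨w2, w2e⟩ : ∃ w, w = mink (dir b e₁ x) (e₂ x) := ⟨_, rfl⟩
  simp only [← w1e, ← w2e, S1, S2, S3, S4] at C31 C32 Ea1 Ea2 Ea3 Eb1 Eb2 Eb3 ⊢
  rw [dir_congr hU P31a hx, dir_const_on hU P31b hx, P31a x hx, P31b x hx, A.dbf x hx, Ea3, Eb3,
    Ea1, Eb1] at C31
  rw [dir_congr hU P32b hx, dir_const_on hU P32a hx, P32a x hx, P32b x hx, dir_const_mul, Ea3, Eb3,
    Ea2, Eb2] at C32
  simp only [mink_add_left, mink_smul_left, mink_add_right, mink_smul_right, F.h11,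
    F.h12, F.h13, F.h14, F.h22, F.h23, F.h24, c21 x hx, mink_comm (e₁ x) (X x), F.q1, F.q2,
    mink_comm (e₂ x) (X x)] at C31 C32
  have f0 := A.fpos x hx
  -- The $e_1$-component of the Codazzi equation has no derivative left because $E_2f=0$; the
  -- $e_2$-component supplies the formula for $E_1f$.
  have : (4 * f x) * w1 = 0 := by linarith
  exact ⟨(mul_eq_zero.1 this).resolve_left (by positivity), by linarith⟩

/-- The connection matrix after all vanishing entries have been inserted. In the direction of $e_1$
the vector $e_2$ decouples from the others, which is the source of the constancy of $E_2$ along the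
integral curves. -/
theorem frame_derivs (A : IsPNMC U X e₁ e₂ e₃ e₄ a b f) (hx : x ∈ U) :
    dir a e₁ x = X x + -f x • e₃ x + mink (dir a e₁ x) (e₄ x) • e₄ x ∧
    dir a e₂ x = 0 ∧
    dir a e₃ x = f x • e₁ x ∧
    dir a e₄ x = -mink (dir a e₁ x) (e₄ x) • e₁ x ∧
    dir b e₁ x = mink (dir b e₁ x) (e₂ x) • e₂ x ∧
    dir b e₂ x = X x + -mink (dir b e₁ x) (e₂ x) • e₁ x + (3 * f x) • e₃ x
      + -mink (dir a e₁ x) (e₄ x) • e₄ x ∧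
    dir b e₃ x = -(3 * f x) • e₂ x ∧
    dir b e₄ x = mink (dir a e₁ x) (e₄ x) • e₂ x := by
  obtain ⟨S1, S2, S3⟩ := A.shape_three hx
  obtain ⟨S4, S5⟩ := A.shape_four hx
  obtain ⟨w, -⟩ := A.geodesic hx
  obtain ⟨-, -, Ea1, Ea2, Ea3, Ea4, Eb1, Eb2, Eb3, Eb4⟩ := A.frame_eqs A.par hx
  rw [S1, S2, S3] at *
  rw [S4, S5] at *
  rw [w] at *
  refine ⟨?_, ?_, ?_, ?_, ?_, ?_, ?_, ?_⟩
  · nth_rw 1 [Ea1]; simp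
  · rw [Ea2]; simp
  · rw [Ea3]; simp
  · nth_rw 1 [Ea4]; simp
  · nth_rw 1 [Eb1]; simp
  · nth_rw 1 [Eb2]
  · rw [Eb3]; simp
  · nth_rw 1 [Eb4]; simp

/-- Codazzi for $e_4$ gives the derivatives of $k$, and Gauss for $(e_1,e_2)$ gives $E_1w$. No
structure equation contains $E_2w$; it comes from the commutator of $E_1$ and $E_2$ acting on $f$.
-/
theorem gauss_codazzi (A : IsPNMC U X e₁ e₂ e₃ e₄ a b f) (hx : x ∈ U) :
    dir a (fun y => mink (dir a e₁ y) (e₄ y)) x =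
      -2 * mink (dir a e₁ x) (e₄ x) * mink (dir b e₁ x) (e₂ x) ∧
    dir b (fun y => mink (dir a e₁ y) (e₄ y)) x = 0 ∧
    dir a (fun y => mink (dir b e₁ y) (e₂ y)) x =
      1 + 3 * f x ^ 2 + mink (dir a e₁ x) (e₄ x) ^ 2 - mink (dir b e₁ x) (e₂ x) ^ 2 ∧
    dir b (fun y => mink (dir b e₁ y) (e₂ y)) x = 0 := by
  have hU := A.isOpen
  have F := A.frame x hx
  obtain ⟨k, kd⟩ : ∃ h : E2 → ℝ, h = fun y => mink (dir a e₁ y) (e₄ y) := ⟨_, rfl⟩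
  obtain ⟨w, wd⟩ : ∃ h : E2 → ℝ, h = fun y => mink (dir b e₁ y) (e₂ y) := ⟨_, rfl⟩
  have ke : ∀ y, mink (dir a e₁ y) (e₄ y) = k y := fun y => by rw [kd]
  have we : ∀ y, mink (dir b e₁ y) (e₂ y) = w y := fun y => by rw [wd]
  have sw : ContDiffOn ℝ ∞ w U := wd ▸ contDiffOn_mink (smooth_dir hU A.s1 A.sb) A.s2
  have E := fun y (hy : y ∈ U) => A.frame_derivs hy
  have hw := fun y (hy : y ∈ U) => (A.geodesic hy).2
  simp only [ke, we] at E hw ⊢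
  obtain ⟨Ea1, Ea2, Ea3, Ea4, Eb1, Eb2, Eb3, Eb4⟩ := E x hx
  have c21 : ∀ y ∈ U, mink (e₂ y) (e₁ y) = 0 := fun y hy => by rw [mink_comm, (A.frame y hy).h12]
  have P41a : ∀ y ∈ U, mink (dir a e₄ y) (e₁ y) = -k y := fun y hy => by
    rw [(E y hy).2.2.2.1]; simp [(A.frame y hy).h11]
  have P42a : ∀ y ∈ U, mink (dir a e₄ y) (e₂ y) = 0 := fun y hy => by
    rw [(E y hy).2.2.2.1]; simp [(A.frame y hy).h12]
  have P41b : ∀ y ∈ U, mink (dir b e₄ y) (e₁ y) = 0 := fun y hy => by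
    rw [(E y hy).2.2.2.2.2.2.2]; simp [c21 y hy]
  have P42b : ∀ y ∈ U, mink (dir b e₄ y) (e₂ y) = k y := fun y hy => by
    rw [(E y hy).2.2.2.2.2.2.2]; simp [(A.frame y hy).h22]
  have P12a : ∀ y ∈ U, mink (dir a e₁ y) (e₂ y) = 0 := fun y hy => (A.geodesic hy).1
  have P12b : ∀ y ∈ U, mink (dir b e₁ y) (e₂ y) = w y := fun y hy => we y
  have C41 := A.structure_eq A.s4 A.s1 hx
  have C42 := A.structure_eq A.s4 A.s2 hx
  have C12 := A.structure_eq A.s1 A.s2 hx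
  rw [P12a x hx, P12b x hx] at C41 C42
  rw [dir_congr hU P41a hx, dir_neg, dir_const_on hU P41b hx, P41a x hx, P41b x hx, Ea1, Eb1, Ea4,
    Eb4] at C41
  rw [dir_congr hU P42b hx, dir_const_on hU P42a hx, P42a x hx, P42b x hx, Ea2, Eb2, Ea4,
    Eb4] at C42
  rw [dir_congr hU P12b hx, dir_const_on hU P12a hx, P12a x hx, P12b x hx, Ea1, Eb1, Ea2,
    Eb2] at C12
  simp only [mink_add_left, mink_smul_left, mink_add_right, mink_smul_right, F.h11, F.h12, F.h13,
    F.h14, F.h23, F.h24, F.h33, F.h34, F.h44, mink_comm (e₁ x) (X x),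
    mink_comm (e₂ x) (X x), mink_comm (e₃ x) (X x), mink_comm (e₄ x) (X x), mink_comm (e₃ x) (e₁ x),
    mink_comm (e₄ x) (e₁ x),
    mink_comm (e₄ x) (e₃ x), F.q1, F.q2, F.q3, F.q4, F.qq, mink_zero_right] at C41 C42 C12
  refine ⟨by linarith, by linarith, by linarith, ?_⟩
  -- As $E_2f=0$ and $\nabla_{E_1}E_1=0$, the commutator yields $E_2(E_1f)=0$. Inserting
  -- $E_1f=-\frac43fw$ leaves $fE_2w=0$.
  have hc := A.dir_comm A.sf hx
  rw [dir_const_on hU A.dbf hx, A.dbf x hx, (A.geodesic hx).1, dir_congr hU hw hx,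
    dir_mul hU (contDiffOn_const.mul A.sf) sw hx, dir_const_mul, A.dbf x hx] at hc
  simp only [smul_eq_mul, mul_zero, zero_mul, neg_zero, add_zero, zero_add, zero_sub] at hc
  have f0 := A.fpos x hx
  have : (4 / 3 * f x) * dir b w x = 0 := by linarith
  exact (mul_eq_zero.1 this).resolve_left (by positivity)

end AdaptedFrame.IsPNMC

/-! ### Immersed surfaces in coordinates -/

/-- `X` parametrizes an immersed surface in `ℍ⁴` over the open set `U`. -/
structure IsParam (U : Set E2) (X : E2 → R51) : Prop where
  isOpen : IsOpen U
  smooth : ContDiffOn ℝ ∞ X U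
  mem : ∀ x ∈ U, X x ∈ H4
  inj : ∀ x ∈ U, Function.Injective (fderiv ℝ X x)

theorem eq_stdVec (v : E2) : v = v 0 • stdVec 0 + v 1 • stdVec 1 := by
  ext i; fin_cases i <;> simp [stdVec]

theorem fderiv_eq_pd {G : Type*} [NormedAddCommGroup G] [NormedSpace ℝ G] (F : E2 → G) (x v : E2) :
    fderiv ℝ F x v = v 0 • pd 0 F x + v 1 • pd 1 F x := by
  conv_lhs => rw [eq_stdVec v, map_add, map_smul, map_smul]
  rfl

namespace IsParam

variable {U : Set E2} {X : E2 → R51} {x : E2}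

theorem smooth_pd {G : Type*} [NormedAddCommGroup G] [NormedSpace ℝ G] {F : E2 → G}
    (hU : IsOpen U) (hF : ContDiffOn ℝ ∞ F U) (i : Fin 2) : ContDiffOn ℝ ∞ (pd i F) U :=
  smooth_dir hU hF contDiffOn_const

theorem pd_pd_comm (P : IsParam U X) (hx : x ∈ U) (i j : Fin 2) :
    pd i (pd j X) x = pd j (pd i X) x := by
  have h := dir_dir_sub (a := fun _ => stdVec i) (b := fun _ => stdVec j) P.isOpen P.smooth
    contDiffOn_const contDiffOn_const hx
  rw [← sub_eq_zero]
  refine h.trans ?_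
  simp [dir]

theorem mink_fderiv (P : IsParam U X) (hx : x ∈ U) (v : E2) : mink (fderiv ℝ X x v) (X x) = 0 := by
  have h := dir_const_on (a := fun _ => v) P.isOpen (fun y hy => (P.mem y hy).1) hx
  rw [dir_mink P.isOpen P.smooth P.smooth hx, mink_comm (X x)] at h
  change mink (fderiv ℝ X x v) (X x) + mink (fderiv ℝ X x v) (X x) = 0 at h
  linarith

theorem mink_pd (P : IsParam U X) (hx : x ∈ U) (i : Fin 2) : mink (pd i X x) (X x) = 0 :=
  P.mink_fderiv hx _

theorem mink_fderiv_pos (P : IsParam U X) (hx : x ∈ U) {v : E2} (hv : v ≠ 0) :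
    0 < mink (fderiv ℝ X x v) (fderiv ℝ X x v) := by
  refine mink_self_pos (P.mem x hx) (P.mink_fderiv hx v) fun h => hv ?_
  exact P.inj x hx (by rw [h, map_zero])

/-- A vector in the tangent plane that is orthogonal to the tangent plane vanishes. -/
theorem eq_of_tangent (P : IsParam U X) (hx : x ∈ U) {u v : E2}
    (h : ∀ w, mink (fderiv ℝ X x u) (fderiv ℝ X x w) = mink (fderiv ℝ X x v) (fderiv ℝ X x w)) :
    u = v := by
  by_contra hne
  have := P.mink_fderiv_pos hx (sub_ne_zero.2 hne)
  have h1 := h (u - v)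
  rw [map_sub] at this h1
  rw [mink_sub_left, h1, sub_self] at this
  exact lt_irrefl _ this

theorem metric_symm (x : E2) (i j : Fin 2) : metric X x i j = metric X x j i := by
  simp [metric, mink_comm]

/-- The vector $g_{11}\partial_0-g_{01}\partial_1$ has squared length $g_{11}\det g$, and both this
length and $g_{11}$ are positive. -/
theorem metric_det_pos (P : IsParam U X) (hx : x ∈ U) : 0 < (metric X x).det := by
  have h1 := P.mink_fderiv_pos hx (v := stdVec 1) (by
    intro h; have := congrArg (fun z : E2 => z 1) h; simp [stdVec] at this)
  have h2 := P.mink_fderiv_pos hx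
    (v := metric X x 1 1 • stdVec 0 - metric X x 0 1 • stdVec 1) (by
      intro h
      have := congrArg (fun z : E2 => z 0) h
      simp [stdVec, metric] at this
      exact h1.ne' this)
  rw [map_sub, map_smul, map_smul] at h2
  change 0 < metric X x 1 1 at h1
  change 0 < mink (metric X x 1 1 • pd 0 X x - metric X x 0 1 • pd 1 X x)
    (metric X x 1 1 • pd 0 X x - metric X x 0 1 • pd 1 X x) at h2
  have e (i j) : mink (pd i X x) (pd j X x) = metric X x i j := rfl
  simp only [mink_sub_left, mink_sub_right, mink_smul_left, mink_smul_right, e] at h2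
  rw [Matrix.det_fin_two]
  rw [metric_symm x 1 0] at *
  refine pos_of_mul_pos_right (a := metric X x 1 1) ?_ h1.le
  linarith

theorem isUnit_det (P : IsParam U X) (hx : x ∈ U) : IsUnit (metric X x).det :=
  (P.metric_det_pos hx).ne'.isUnit

/-- The metric applied to the inverse metric. -/
theorem sum_inv_metric (P : IsParam U X) (hx : x ∈ U) (S : Fin 2 → ℝ) (l : Fin 2) :
    ∑ k, (∑ m, (metric X x)⁻¹ k m * S m) * metric X x k l = S l := by
  have h := Matrix.mul_nonsing_inv (metric X x) (P.isUnit_det hx)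
  have h0 : ∀ m, metric X x l 0 * (metric X x)⁻¹ 0 m + metric X x l 1 * (metric X x)⁻¹ 1 m
      = (1 : Matrix (Fin 2) (Fin 2) ℝ) l m := fun m => by
    rw [← h, Matrix.mul_apply, Fin.sum_univ_two]
  simp only [Fin.sum_univ_two]
  rw [metric_symm x 0 l, metric_symm x 1 l]
  have e0 := h0 0
  have e1 := h0 1
  have : ∀ l, S l = S 0 * (1 : Matrix (Fin 2) (Fin 2) ℝ) l 0
      + S 1 * (1 : Matrix (Fin 2) (Fin 2) ℝ) l 1 := by
    rw [Fin.forall_fin_two]; constructor <;> simp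
  rw [this l, ← e0, ← e1]; ring

/-- By the product rule and the symmetry of second partials, the combination of metric derivatives
collapses to one term. Hence the Christoffel term in the second fundamental form is exactly the
tangential part of the second derivative. -/
theorem christoffel_pairing (P : IsParam U X) (hx : x ∈ U) (i j l : Fin 2) :
    ∑ k, christoffel X k i j x * metric X x k l = mink (pd i (pd j X) x) (pd l X x) := by
  unfold christoffel
  rw [P.sum_inv_metric hx]
  have hp : ∀ a b c : Fin 2, pd a (fun y => metric X y b c) x =
      mink (pd a (pd b X) x) (pd c X x) + mink (pd b X x) (pd a (pd c X) x) := fun a b c =>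
    dir_mink (a := fun _ => stdVec a) P.isOpen (smooth_pd P.isOpen P.smooth b)
      (smooth_pd P.isOpen P.smooth c) hx
  rw [hp, hp, hp, P.pd_pd_comm hx j i, P.pd_pd_comm hx l i, P.pd_pd_comm hx l j,
    mink_comm (pd j X x), mink_comm (pd i X x)]
  ring

theorem sff_eq (X : E2 → R51) (i j : Fin 2) (x : E2) :
    sff X i j x = pd i (pd j X) x + mink (pd i (pd j X) x) (X x) • X x
      - (christoffel X 0 i j x • pd 0 X x + christoffel X 1 i j x • pd 1 X x) := by
  simp [sff, covD, projH4, Fin.sum_univ_two]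

theorem sff_pd (P : IsParam U X) (hx : x ∈ U) (i j l : Fin 2) :
    mink (sff X i j x) (pd l X x) = 0 := by
  have h := P.christoffel_pairing hx i j l
  have e (i j) : mink (pd i X x) (pd j X x) = metric X x i j := rfl
  rw [Fin.sum_univ_two] at h
  rw [sff_eq, mink_sub_left, mink_add_left, ← h]
  simp [e, mink_comm (X x), P.mink_pd hx]

theorem sff_self (P : IsParam U X) (hx : x ∈ U) (i j : Fin 2) :
    mink (sff X i j x) (X x) = 0 := by
  rw [sff_eq]
  simp [P.mink_pd hx, (P.mem x hx).1]

/-! #### Orthonormal bases -/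

/-- If $Q$ has columns $u,v$, orthonormality says $Q^{\mathsf T}gQ=1$, so $g^{-1}=QQ^{\mathsf T}$.
Traces with respect to $g$ thus become sums over an orthonormal basis. -/
theorem inv_metric_eq {u v : E2} (huu : mink (fderiv ℝ X x u) (fderiv ℝ X x u) = 1)
    (huv : mink (fderiv ℝ X x u) (fderiv ℝ X x v) = 0)
    (hvv : mink (fderiv ℝ X x v) (fderiv ℝ X x v) = 1) (i j : Fin 2) :
    (metric X x)⁻¹ i j = u i * u j + v i * v j := by
  have e (i j) : mink (pd i X x) (pd j X x) = metric X x i j := rfl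
  rw [fderiv_eq_pd X x u] at huu huv
  rw [fderiv_eq_pd X x v] at huv hvv
  simp only [mink_add_left, mink_add_right, mink_smul_left, mink_smul_right, e,
    metric_symm x 1 0] at huu huv hvv
  set Q : Matrix (Fin 2) (Fin 2) ℝ := !![u 0, v 0; u 1, v 1] with hQ
  have h1 : (Q.transpose * metric X x) * Q = 1 := by
    ext a b
    fin_cases a <;> fin_cases b <;>
      simp [hQ, Matrix.mul_apply, Fin.sum_univ_two, metric_symm x 1 0] <;> linarith
  have h2 : Q * Q.transpose * metric X x = 1 := by
    rw [Matrix.mul_assoc]; exact mul_eq_one_comm.1 h1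
  rw [Matrix.inv_eq_left_inv h2]
  fin_cases i <;> fin_cases j <;> simp [hQ, Matrix.mul_apply, Fin.sum_univ_two]

/-- The second fundamental form evaluated on `(u, v)`. -/
noncomputable def sffq (X : E2 → R51) (x u v : E2) : R51 :=
  ∑ i, ∑ j, (u i * v j) • sff X i j x

theorem tension_eq {u v : E2} (huu : mink (fderiv ℝ X x u) (fderiv ℝ X x u) = 1)
    (huv : mink (fderiv ℝ X x u) (fderiv ℝ X x v) = 0)
    (hvv : mink (fderiv ℝ X x v) (fderiv ℝ X x v) = 1) :
    tension X x = sffq X x u u + sffq X x v v := by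
  simp only [tension, sffq, inv_metric_eq huu huv hvv, add_smul, Finset.sum_add_distrib]

theorem sum_pd_pd {G : Type*} [NormedAddCommGroup G] [NormedSpace ℝ G] {F : E2 → G}
    (hU : IsOpen U) (hF : ContDiffOn ℝ ∞ F U) (hx : x ∈ U) (u v : E2) :
    ∑ i, ∑ j, (u i * v j) • pd i (pd j F) x = fderiv ℝ (fderiv ℝ F) x u v := by
  have e : ∀ i j, pd i (pd j F) x = fderiv ℝ (fderiv ℝ F) x (stdVec i) (stdVec j) := fun i j => by
    have := dir_dir (a := fun _ => stdVec i) (b := fun _ => stdVec j) hU hF contDiffOn_const hx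
    refine Eq.trans this ?_
    simp [dir]
  conv_rhs => rw [eq_stdVec u, eq_stdVec v]
  simp only [e, Fin.sum_univ_two, map_add, map_smul, add_apply, smul_apply]
  module

/-- Modulo the position vector and the tangent plane, the second fundamental form is the ordinary
second derivative. The correction terms stay unspecified since orthogonality removes them later. -/
theorem exists_sffq_eq (P : IsParam U X) (hx : x ∈ U) (u v : E2) :
    ∃ (c : ℝ) (w : E2), sffq X x u v =
      fderiv ℝ (fderiv ℝ X) x u v + c • X x + fderiv ℝ X x w := by
  refine ⟨∑ i, ∑ j, (u i * v j) * mink (pd i (pd j X) x) (X x),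
    -∑ i, ∑ j, (u i * v j) • (christoffel X 0 i j x • stdVec 0 + christoffel X 1 i j x • stdVec 1),
    ?_⟩
  rw [← sum_pd_pd P.isOpen P.smooth hx]
  simp only [sffq, sff_eq, Fin.sum_univ_two, map_add, map_smul, map_neg]
  simp only [pd]
  module

theorem sffq_self (P : IsParam U X) (hx : x ∈ U) (u v : E2) : mink (sffq X x u v) (X x) = 0 := by
  simp [sffq, Fin.sum_univ_two, P.sff_self hx]

theorem sffq_tangent (P : IsParam U X) (hx : x ∈ U) (u v w : E2) :
    mink (sffq X x u v) (fderiv ℝ X x w) = 0 := by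
  rw [fderiv_eq_pd]
  simp [sffq, Fin.sum_univ_two, P.sff_pd hx]

theorem sffq_normal (P : IsParam U X) (hx : x ∈ U) (u v : E2) {ν : R51} (h : mink (X x) ν = 0)
    (h' : ∀ w, mink (fderiv ℝ X x w) ν = 0) :
    mink (sffq X x u v) ν = mink (fderiv ℝ (fderiv ℝ X) x u v) ν := by
  obtain ⟨c, w, e⟩ := P.exists_sffq_eq hx u v
  simp [e, h, h']

/-- The second fundamental form does not depend on the parametrization. -/
theorem sffq_comp (P : IsParam U X) {V : Set E2} {Y : E2 → R51} (Q : IsParam V Y) {y : E2}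
    (hy : y ∈ V) {ψ : E2 → E2} (hψ : ContDiffAt ℝ ∞ ψ y) (hψy : ψ y ∈ U) (hYX : Y =ᶠ[nhds y] X ∘ ψ)
    (u v : E2) :
    sffq Y y u v = sffq X (ψ y) (fderiv ℝ ψ y u) (fderiv ℝ ψ y v) := by
  have hDX := P.smooth.fderiv_of_isOpen P.isOpen (m := ∞) (by simp)
  have hXd : ∀ᶠ z in nhds y, DifferentiableAt ℝ X (ψ z) := by
    filter_upwards [hψ.continuousAt.preimage_mem_nhds (P.isOpen.mem_nhds hψy)] with z hz
    exact differentiableAt_of_smooth P.isOpen P.smooth hz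
  have hψd : ∀ᶠ z in nhds y, DifferentiableAt ℝ ψ z := by
    filter_upwards [(hψ.of_le (m := 1) (by simp)).eventually (by simp)] with z hz
    exact hz.differentiableAt (by simp)
  have hD : fderiv ℝ Y =ᶠ[nhds y] fun z => (fderiv ℝ X (ψ z)).comp (fderiv ℝ ψ z) := by
    filter_upwards [hYX.eventuallyEq_nhds, hXd, hψd] with z h1 h2 h3
    rw [h1.fderiv_eq, fderiv_comp z h2 h3]
  have hY0 : Y y = X (ψ y) := hYX.eq_of_nhds
  have hD0 : ∀ w, fderiv ℝ Y y w = fderiv ℝ X (ψ y) (fderiv ℝ ψ y w) := fun w => by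
    rw [hD.eq_of_nhds]; rfl
  have hD2 : fderiv ℝ (fderiv ℝ Y) y u v = fderiv ℝ (fderiv ℝ X) (ψ y) (fderiv ℝ ψ y u)
      (fderiv ℝ ψ y v) + fderiv ℝ X (ψ y) (fderiv ℝ (fderiv ℝ ψ) y u v) := by
    have h1 : HasFDerivAt (fderiv ℝ X) (fderiv ℝ (fderiv ℝ X) (ψ y)) (ψ y) :=
      (differentiableAt_of_smooth P.isOpen hDX hψy).hasFDerivAt
    have h2 : HasFDerivAt (fderiv ℝ ψ) (fderiv ℝ (fderiv ℝ ψ) y) y :=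
      ((hψ.fderiv_right (m := ∞) (by simp)).differentiableAt (by simp)).hasFDerivAt
    have h3 := h1.comp y hψd.self_of_nhds.hasFDerivAt
    have h4 : HasFDerivAt (fun z => (fderiv ℝ X (ψ z)).comp (fderiv ℝ ψ z)) _ y := h3.clm_comp h2
    rw [hD.fderiv_eq, h4.fderiv]
    simp [add_comm]
  obtain ⟨c, w, e⟩ := P.exists_sffq_eq hψy (fderiv ℝ ψ y u) (fderiv ℝ ψ y v)
  obtain ⟨c', w', e'⟩ := Q.exists_sffq_eq hy u v
  -- By the chain rule the two second fundamental forms differ by a multiple of $X$ plus the tangent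
  -- vector $dX(d)$. Both forms are orthogonal to $X$ and to the tangent plane, so the two terms
  -- vanish. The injectivity of $D\psi$ is needed to see $dX(d)$ as tangent in the other
  -- parametrization too.
  set d := fderiv ℝ (fderiv ℝ ψ) y u v + fderiv ℝ ψ y w' - w
  have hdiff : sffq Y y u v - sffq X (ψ y) (fderiv ℝ ψ y u) (fderiv ℝ ψ y v) =
      (c' - c) • X (ψ y) + fderiv ℝ X (ψ y) d := by
    rw [e, e', hD2, hD0, hY0, map_sub, map_add]; module
  obtain ⟨d', hd'⟩ : ∃ d', fderiv ℝ ψ y d' = d := by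
    refine LinearMap.injective_iff_surjective (f := (fderiv ℝ ψ y).toLinearMap) |>.1 ?_ d
    intro p q hpq
    exact Q.inj y hy (by rw [hD0, hD0]; exact congrArg _ hpq)
  have h1 := congrArg (fun z => mink z (X (ψ y))) hdiff
  have h2 := congrArg (fun z => mink z (fderiv ℝ X (ψ y) d)) hdiff
  have h3 : mink (sffq Y y u v) (fderiv ℝ X (ψ y) d) = 0 := by
    rw [← hd', ← hD0]; exact Q.sffq_tangent hy _ _ _
  have h0 : mink (sffq Y y u v) (X (ψ y)) = 0 := by rw [← hY0]; exact Q.sffq_self hy _ _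
  simp only [mink_sub_left, mink_add_left, mink_smul_left, P.sffq_self hψy,
    P.mink_fderiv hψy, (P.mem _ hψy).1, h0] at h1
  have hc : c' - c = 0 := by linarith
  rw [hc, zero_smul, zero_add] at hdiff h2
  simp only [mink_sub_left, h3, P.sffq_tangent hψy, sub_zero] at h2
  have hd : d = 0 := by
    by_contra hne
    exact (P.mink_fderiv_pos hψy hne).ne h2
  rw [hd, map_zero] at hdiff
  exact sub_eq_zero.1 hdiff

/-- A basis orthonormal for one parametrization is carried by $D\psi$ to one orthonormal for the
other, so the invariance of the second fundamental form passes to its trace. -/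
theorem tension_comp (P : IsParam U X) {V : Set E2} {Y : E2 → R51} (Q : IsParam V Y) {y : E2}
    (hy : y ∈ V) {ψ : E2 → E2} (hψ : ContDiffAt ℝ ∞ ψ y) (hψy : ψ y ∈ U) (hYX : Y =ᶠ[nhds y] X ∘ ψ)
    {u v : E2} (huu : mink (fderiv ℝ Y y u) (fderiv ℝ Y y u) = 1)
    (huv : mink (fderiv ℝ Y y u) (fderiv ℝ Y y v) = 0)
    (hvv : mink (fderiv ℝ Y y v) (fderiv ℝ Y y v) = 1) : tension Y y = tension X (ψ y) := by
  have hD0 : ∀ w, fderiv ℝ Y y w = fderiv ℝ X (ψ y) (fderiv ℝ ψ y w) := fun w => by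
    rw [hYX.fderiv_eq, fderiv_comp y (differentiableAt_of_smooth P.isOpen P.smooth hψy)
      (hψ.differentiableAt (by simp))]
    rfl
  rw [tension_eq huu huv hvv, P.sffq_comp Q hy hψ hψy hYX, P.sffq_comp Q hy hψ hψy hYX]
  rw [hD0 u] at huu huv
  rw [hD0 v] at huv hvv
  rw [tension_eq huu huv hvv]

end IsParam

namespace IsParam

variable {U : Set E2} {X : E2 → R51} {x : E2}

/-! #### Smoothness of the geometric quantities -/

theorem smooth_metric (P : IsParam U X) (i j : Fin 2) :
    ContDiffOn ℝ ∞ (fun y => metric X y i j) U :=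
  contDiffOn_mink (smooth_pd P.isOpen P.smooth i) (smooth_pd P.isOpen P.smooth j)

theorem smooth_inv_metric (P : IsParam U X) (i j : Fin 2) :
    ContDiffOn ℝ ∞ (fun y => (metric X y)⁻¹ i j) U := by
  have hdet : ContDiffOn ℝ ∞ (fun y => (metric X y).det) U := by
    simp only [Matrix.det_fin_two]
    exact ((P.smooth_metric 0 0).mul (P.smooth_metric 1 1)).sub
      ((P.smooth_metric 0 1).mul (P.smooth_metric 1 0))
  have hinv := hdet.inv fun y hy => (P.metric_det_pos hy).ne'
  have e : ∀ y, (metric X y)⁻¹ i j = ((metric X y).det)⁻¹ * (metric X y).adjugate i j := fun y => by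
    rw [Matrix.inv_def, Ring.inverse_eq_inv']; rfl
  simp only [e, Matrix.adjugate_fin_two]
  refine hinv.mul ?_
  fin_cases i <;> fin_cases j
  · exact P.smooth_metric 1 1
  · exact (P.smooth_metric 0 1).neg
  · exact (P.smooth_metric 1 0).neg
  · exact P.smooth_metric 0 0

theorem smooth_christoffel (P : IsParam U X) (k i j : Fin 2) :
    ContDiffOn ℝ ∞ (christoffel X k i j) U := by
  refine ContDiffOn.sum fun l _ => (P.smooth_inv_metric k l).mul (contDiffOn_const.mul ?_)
  exact ((smooth_pd P.isOpen (P.smooth_metric j l) i).add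
    (smooth_pd P.isOpen (P.smooth_metric i l) j)).sub (smooth_pd P.isOpen (P.smooth_metric i j) l)

theorem smooth_sff (P : IsParam U X) (i j : Fin 2) : ContDiffOn ℝ ∞ (sff X i j) U := by
  have h := smooth_pd P.isOpen (smooth_pd P.isOpen P.smooth j) i
  refine (h.add ((contDiffOn_mink h P.smooth).smul P.smooth)).sub ?_
  exact ContDiffOn.sum fun k _ => (P.smooth_christoffel k i j).smul (smooth_pd P.isOpen P.smooth k)

theorem smooth_tension (P : IsParam U X) : ContDiffOn ℝ ∞ (tension X) U :=
  ContDiffOn.sum fun i _ => ContDiffOn.sum fun j _ => (P.smooth_inv_metric i j).smul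
    (P.smooth_sff i j)

theorem tension_self (P : IsParam U X) (hx : x ∈ U) : mink (tension X x) (X x) = 0 := by
  simp [tension, Fin.sum_univ_two, P.sff_self hx]

theorem tension_tangent (P : IsParam U X) (hx : x ∈ U) (w : E2) :
    mink (tension X x) (fderiv ℝ X x w) = 0 := by
  rw [fderiv_eq_pd]
  simp [tension, Fin.sum_univ_two, P.sff_pd hx]

/-! #### Gradients -/

/-- The gradient of `h`, as a vector of `ℝ⁵₁`. -/
noncomputable def gradVec (X : E2 → R51) (h : E2 → ℝ) (x : E2) : E2 :=
  ∑ i, ∑ j, ((metric X x)⁻¹ i j * pd j h x) • stdVec i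

theorem gradVec_pairing (P : IsParam U X) (hx : x ∈ U) (h : E2 → ℝ) (w : E2) :
    mink (fderiv ℝ X x (gradVec X h x)) (fderiv ℝ X x w) = fderiv ℝ h x w := by
  have e (i j) : mink (pd i X x) (pd j X x) = metric X x i j := rfl
  have es (i) : fderiv ℝ X x (stdVec i) = pd i X x := rfl
  have h1 : ∀ k, mink (fderiv ℝ X x (gradVec X h x)) (pd k X x) = pd k h x := fun k => by
    rw [← P.sum_inv_metric hx (fun j => pd j h x) k]
    simp only [gradVec, Fin.sum_univ_two, map_add, map_smul, mink_add_left, mink_smul_left, e, es]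
    ring
  rw [fderiv_eq_pd X x w, fderiv_eq_pd h x w, mink_add_right, mink_smul_right, mink_smul_right,
    h1, h1]
  rfl

theorem smooth_gradVec (P : IsParam U X) {h : E2 → ℝ} (hh : ContDiffOn ℝ ∞ h U) :
    ContDiffOn ℝ ∞ (gradVec X h) U :=
  ContDiffOn.sum fun i _ => ContDiffOn.sum fun j _ =>
    ((P.smooth_inv_metric i j).mul (smooth_pd P.isOpen hh j)).smul contDiffOn_const

/-- Coordinates of a tangent vector of the surface. -/
noncomputable def tangentVec (X : E2 → R51) (v : R51) (x : E2) : E2 :=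
  ∑ i, ∑ j, ((metric X x)⁻¹ i j * mink v (pd j X x)) • stdVec i

theorem tangentVec_fderiv (P : IsParam U X) (hx : x ∈ U) (u : E2) :
    tangentVec X (fderiv ℝ X x u) x = u := by
  refine P.eq_of_tangent hx fun w => ?_
  have e (i j) : mink (pd i X x) (pd j X x) = metric X x i j := rfl
  have es (i) : fderiv ℝ X x (stdVec i) = pd i X x := rfl
  have h1 : ∀ k, mink (fderiv ℝ X x (tangentVec X (fderiv ℝ X x u) x)) (pd k X x) =
      mink (fderiv ℝ X x u) (pd k X x) := fun k => by
    rw [← P.sum_inv_metric hx (fun j => mink (fderiv ℝ X x u) (pd j X x)) k]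
    simp only [tangentVec, Fin.sum_univ_two, map_add, map_smul, mink_add_left, mink_smul_left, e,
      es]
    ring
  rw [fderiv_eq_pd X x w, mink_add_right, mink_smul_right, mink_smul_right, h1, h1]
  simp

theorem smooth_tangentVec (P : IsParam U X) {v : E2 → R51} (hv : ContDiffOn ℝ ∞ v U) :
    ContDiffOn ℝ ∞ (fun y => tangentVec X (v y) y) U :=
  ContDiffOn.sum fun i _ => ContDiffOn.sum fun j _ => ((P.smooth_inv_metric i j).mul
    (contDiffOn_mink hv (smooth_pd P.isOpen P.smooth j))).smul contDiffOn_const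

/-! #### The tangential part of the bitension field -/

/-- The quadratic form of the Christoffel symbols. -/
noncomputable def gam (X : E2 → R51) (x u : E2) : E2 :=
  ∑ i, ∑ j, (u i * u j) • ∑ k, christoffel X k i j x • stdVec k

theorem gam_pairing (P : IsParam U X) (hx : x ∈ U) (u w : E2) :
    mink (fderiv ℝ X x (gam X x u)) (fderiv ℝ X x w) =
      mink (fderiv ℝ (fderiv ℝ X) x u u) (fderiv ℝ X x w) := by
  have e (i j) : mink (pd i X x) (pd j X x) = metric X x i j := rfl
  have es (i) : fderiv ℝ X x (stdVec i) = pd i X x := rfl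
  have h1 : ∀ k, mink (fderiv ℝ X x (gam X x u)) (pd k X x) =
      mink (fderiv ℝ (fderiv ℝ X) x u u) (pd k X x) := fun k => by
    rw [← sum_pd_pd P.isOpen P.smooth hx]
    simp only [gam, Fin.sum_univ_two, map_add, map_smul, mink_add_left, mink_smul_left, e,
      es, ← P.christoffel_pairing hx]
  rw [fderiv_eq_pd X x w, mink_add_right, mink_smul_right, mink_smul_right, h1, h1]
  simp

/-- Only flat derivatives matter for the tangential part. Since $\tau$ is orthogonal to $X$ and to
the surface, covariant and flat derivatives differ by multiples of $X$, and the curvature term is a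
multiple of $\tau$. The vector $m$ represents $\nabla_aa+\nabla_bb$ and is characterised by its
pairings, so that it can be computed in a frame. -/
theorem bitension_tangent (P : IsParam U X) {a b : E2 → E2} (ha : ContDiffOn ℝ ∞ a U)
    (hb : ContDiffOn ℝ ∞ b U) (hx : x ∈ U)
    (haa : mink (fderiv ℝ X x (a x)) (fderiv ℝ X x (a x)) = 1)
    (hab : mink (fderiv ℝ X x (a x)) (fderiv ℝ X x (b x)) = 0)
    (hbb : mink (fderiv ℝ X x (b x)) (fderiv ℝ X x (b x)) = 1) :
    ∃ m : E2, (∀ w, mink (fderiv ℝ X x m) (fderiv ℝ X x w) =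
        mink (dir a (dir a X) x + dir b (dir b X) x) (fderiv ℝ X x w)) ∧
      ∀ w, mink (bitension X x) (fderiv ℝ X x w) =
        mink (dir a (dir a (tension X)) x + dir b (dir b (tension X)) x
          - fderiv ℝ (tension X) x m) (fderiv ℝ X x w) := by
  have hU := P.isOpen
  have sT := P.smooth_tension
  refine ⟨dir a a x + gam X x (a x) + (dir b b x + gam X x (b x)), fun w => ?_, fun w => ?_⟩
  · rw [dir_dir hU P.smooth ha hx, dir_dir hU P.smooth hb hx]
    simp only [map_add, mink_add_left, P.gam_pairing hx]
    ring
  -- Differentiating $\langle\tau,X\rangle=0$ and using $\tau\perp dX$ shows that the first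
  -- derivatives of $\tau$ are already tangent to $\mathbb H^4$.
  have hcov : ∀ j, ∀ y ∈ U, covD X j (tension X) y = pd j (tension X) y := fun j y hy => by
    have h := dir_const_on (a := fun _ => stdVec j) hU (fun z hz => P.tension_self hz) hy
    rw [dir_mink hU sT P.smooth hy] at h
    have h2 : mink (tension X y) (dir (fun _ => stdVec j) X y) = 0 := P.tension_tangent hy _
    rw [h2, add_zero] at h
    change mink (pd j (tension X) y) (X y) = 0 at h
    simp [covD, projH4, h]
  have hcov2 : ∀ i j, covD X i (covD X j (tension X)) x = pd i (pd j (tension X)) x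
      + mink (pd i (pd j (tension X)) x) (X x) • X x := fun i j => by
    rw [covD, projH4, show pd i (covD X j (tension X)) x = pd i (pd j (tension X)) x from
      dir_congr (a := fun _ => stdVec i) hU (hcov j) hx]
  have hq : mink (X x) (fderiv ℝ X x w) = 0 := by rw [mink_comm]; exact P.mink_fderiv hx w
  have hTt := P.tension_tangent hx w
  have hTp : ∀ i, mink (tension X x) (pd i X x) = 0 := fun i => P.tension_tangent hx _
  rw [dir_dir hU sT ha hx, dir_dir hU sT hb hx, ← sum_pd_pd hU sT hx, ← sum_pd_pd hU sT hx]
  have es (i) : fderiv ℝ (tension X) x (stdVec i) = pd i (tension X) x := rfl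
  simp only [bitension, roughLaplacian, hcov2, curvH4, Fin.sum_univ_two, hcov _ x hx,
    inv_metric_eq haa hab hbb, gam, map_add, map_smul, es, mink_add_left, mink_sub_left,
    mink_neg_left, mink_smul_left, hq, hTt, hTp]
  ring

end IsParam

/-! ### From coordinate formulas to moving frames -/

namespace AdaptedFrame

variable {U : Set E2} {X e₁ e₂ e₃ e₄ : E2 → R51} {a b : E2 → E2} {f : E2 → ℝ} {x : E2}

theorem normal_three (A : AdaptedFrame U X e₁ e₂ e₃ e₄ a b) (hx : x ∈ U) (w : E2) :
    mink (fderiv ℝ X x w) (e₃ x) = 0 := by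
  obtain ⟨α, β, rfl⟩ := A.exists_comb hx w
  simp [A.dXa x hx, A.dXb x hx, (A.frame x hx).h13, (A.frame x hx).h23]

theorem normal_four (A : AdaptedFrame U X e₁ e₂ e₃ e₄ a b) (hx : x ∈ U) (w : E2) :
    mink (fderiv ℝ X x w) (e₄ x) = 0 := by
  obtain ⟨α, β, rfl⟩ := A.exists_comb hx w
  simp [A.dXa x hx, A.dXb x hx, (A.frame x hx).h14, (A.frame x hx).h24]

/-- The second fundamental form in terms of derivatives of the frame. -/
theorem sffq_normal (A : AdaptedFrame U X e₁ e₂ e₃ e₄ a b) (P : IsParam U X) (hx : x ∈ U) {ν : R51}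
    (h : mink (X x) ν = 0) (h' : ∀ w, mink (fderiv ℝ X x w) ν = 0) :
    mink (IsParam.sffq X x (a x) (a x)) ν = mink (dir a e₁ x) ν ∧
    mink (IsParam.sffq X x (a x) (b x)) ν = mink (dir a e₂ x) ν ∧
    mink (IsParam.sffq X x (b x) (b x)) ν = mink (dir b e₂ x) ν := by
  have E1 : ∀ v, dir v (dir a X) x = dir v e₁ x := fun v =>
    dir_congr A.isOpen (fun y hy => A.dXa y hy) hx
  have E2 : ∀ v, dir v (dir b X) x = dir v e₂ x := fun v =>
    dir_congr A.isOpen (fun y hy => A.dXb y hy) hx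
  rw [P.sffq_normal hx _ _ h h', P.sffq_normal hx _ _ h h', P.sffq_normal hx _ _ h h', ← E1, ← E2,
    ← E2, dir_dir A.isOpen P.smooth A.sa hx, dir_dir A.isOpen P.smooth A.sb hx,
    dir_dir A.isOpen P.smooth A.sb hx]
  simp [h']

theorem isPNMC (A : AdaptedFrame U X e₁ e₂ e₃ e₄ a b) (P : IsParam U X)
    (sf : ContDiffOn ℝ ∞ f U) (fpos : ∀ x ∈ U, 0 < f x) (daf : ∀ x ∈ U, 0 < dir a f x)
    (dbf : ∀ x ∈ U, dir b f x = 0) (par : ∀ x ∈ U, ∀ v, mink (fderiv ℝ e₃ x v) (e₄ x) = 0)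
    (hT : ∀ x ∈ U, tension X x = (2 * f x) • e₃ x)
    (hbi : ∀ x ∈ U, ∀ w, mink (bitension X x) (fderiv ℝ X x w) = 0) :
    IsPNMC U X e₁ e₂ e₃ e₄ a b f := by
  have hU := A.isOpen
  have ho : ∀ x ∈ U, mink (fderiv ℝ X x (a x)) (fderiv ℝ X x (a x)) = 1 ∧
      mink (fderiv ℝ X x (a x)) (fderiv ℝ X x (b x)) = 0 ∧
      mink (fderiv ℝ X x (b x)) (fderiv ℝ X x (b x)) = 1 := fun x hx => by
    rw [A.dXa x hx, A.dXb x hx]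
    exact ⟨(A.frame x hx).h11, (A.frame x hx).h12, (A.frame x hx).h22⟩
  have hm : ∀ x ∈ U, ∀ ν, mink (X x) ν = 0 → (∀ w, mink (fderiv ℝ X x w) ν = 0) →
      mink (dir a e₁ x + dir b e₂ x) ν = mink (tension X x) ν := fun x hx ν h h' => by
    obtain ⟨h1, h2, h3⟩ := ho x hx
    obtain ⟨s1, -, s2⟩ := A.sffq_normal P hx h h'
    rw [IsParam.tension_eq h1 h2 h3, mink_add_left, mink_add_left, s1, s2]
  have hbit : ∀ x ∈ U, ∀ w, mink (dir a (dir a fun y => (2 * f y) • e₃ y) x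
      + dir b (dir b fun y => (2 * f y) • e₃ y) x
      - (mink (dir a e₁ x) (e₂ x) • dir b (fun y => (2 * f y) • e₃ y) x
        - mink (dir b e₁ x) (e₂ x) • dir a (fun y => (2 * f y) • e₃ y) x))
      (fderiv ℝ X x w) = 0 := fun x hx w => by
    obtain ⟨h1, h2, h3⟩ := ho x hx
    obtain ⟨m, hm1, hm2⟩ := P.bitension_tangent A.sa A.sb hx h1 h2 h3
    have F := A.frame x hx
    -- The tangential part of $D_ae_1+D_be_2$ is $\omega_1e_2-\omega_2e_1$, by skewness of the
    -- connection matrix.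
    have hm' : m = mink (dir a e₁ x) (e₂ x) • b x - mink (dir b e₁ x) (e₂ x) • a x := by
      refine P.eq_of_tangent hx fun w => ?_
      rw [hm1, dir_congr hU (F := dir a X) (K := e₁) (fun y hy => A.dXa y hy) hx,
        dir_congr hU (F := dir b X) (K := e₂) (fun y hy => A.dXb y hy) hx]
      obtain ⟨α, β, rfl⟩ := A.exists_comb hx w
      have t1 := A.dir_anti A.s1 A.s1 (c := 1) (fun y hy => (A.frame y hy).h11) a hx
      have t2 := A.dir_anti A.s2 A.s2 (c := 1) (fun y hy => (A.frame y hy).h22) b hx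
      have t3 := A.dir_anti A.s2 A.s1 (c := 0)
        (fun y hy => by rw [mink_comm]; exact (A.frame y hy).h12) b hx
      have t1' : mink (dir a e₁ x) (e₁ x) = 0 := by linarith
      have t2' : mink (dir b e₂ x) (e₂ x) = 0 := by linarith
      simp [A.dXa x hx, A.dXb x hx, F.h11, F.h12, F.h22, mink_comm (e₂ x) (e₁ x), t1', t2', t3]
    have hTc : ∀ v : E2 → E2, Set.EqOn (dir v (tension X))
        (dir v fun y => (2 * f y) • e₃ y) U := fun v y hy => dir_congr hU hT hy
    have := hm2 w
    rw [hbi x hx w, hm', map_sub, map_smul, map_smul, dir_congr hU (hTc a) hx,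
      dir_congr hU (hTc b) hx] at this
    rw [← hTc a hx, ← hTc b hx]
    exact this.symm
  exact { toAdaptedFrame := A, sf, fpos, daf, dbf, par
          mean3 := fun x hx => by
            rw [hm x hx _ (A.frame x hx).q3 (A.normal_three hx), hT x hx, mink_smul_left,
              (A.frame x hx).h33, mul_one]
          mean4 := fun x hx => by
            rw [hm x hx _ (A.frame x hx).q4 (A.normal_four hx), hT x hx, mink_smul_left,
              (A.frame x hx).h34, mul_zero]
          bi1 := fun x hx => by simpa only [A.dXa x hx] using hbit x hx (a x)
          bi2 := fun x hx => by simpa only [A.dXb x hx] using hbit x hx (b x) }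

end AdaptedFrame

/-! ### Surfaces in charts -/

section Charts

variable {M : Type*} [TopologicalSpace M] [ChartedSpace E2 M]

/-- The derivative of the chart `e` at `q`. -/
noncomputable def dch (e : OpenPartialHomeomorph M E2) (q : M) (v : TangentSpace (𝓡 2) q) : E2 :=
  mfderiv (𝓡 2) (𝓡 2) e q v

variable {e : OpenPartialHomeomorph M E2} {q : M}

theorem dch_smul (r : ℝ) (v : TangentSpace (𝓡 2) q) : dch e q (r • v) = r • dch e q v :=
  map_smul _ _ _

variable [IsManifold (𝓡 2) ∞ M]

theorem mdifferentiable_chart_of_mem (he : e ∈ atlas E2 M) : e.MDifferentiable (𝓡 2) (𝓡 2) :=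
  haveI : IsManifold (𝓡 2) 1 M := IsManifold.of_le (n := ∞) (by simp)
  mdifferentiable_of_mem_atlas he

theorem dch_surjective (he : e ∈ atlas E2 M) (hq : q ∈ e.source) : Function.Surjective (dch e q) :=
  (mdifferentiable_chart_of_mem he).mfderiv_surjective hq

/-- The tangent space at `p` is modelled on the plane through the preferred chart at `p`, so this
chart has identity derivative there. Definitions made with that chart thereby become coordinate
formulas. -/
theorem dch_self (p : M) (v : TangentSpace (𝓡 2) p) : dch (chartAt E2 p) p v = v := by
  have : IsManifold (𝓡 2) 1 M := IsManifold.of_le (n := ∞) (by simp)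
  have h := mfderiv_extChartAt_self (I := 𝓡 2) (x := p)
  exact congrArg (fun L => L v) h

variable {G : Type*} [NormedAddCommGroup G] [NormedSpace ℝ G]

theorem hasMFDerivAt_chart (he : e ∈ atlas E2 M) (hq : q ∈ e.source) {h : M → G}
    (hd : DifferentiableAt ℝ (h ∘ e.symm) (e q)) :
    HasMFDerivAt (𝓡 2) 𝓘(ℝ, G) h q
      ((fderiv ℝ (h ∘ e.symm) (e q)).comp (mfderiv (𝓡 2) (𝓡 2) e q)) := by
  have h1 : HasMFDerivAt (𝓡 2) (𝓡 2) e q (mfderiv (𝓡 2) (𝓡 2) e q) :=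
    ((mdifferentiable_chart_of_mem he).mdifferentiableAt hq).hasMFDerivAt
  have h2 : HasMFDerivAt (𝓡 2) 𝓘(ℝ, G) (h ∘ e.symm) (e q) (fderiv ℝ (h ∘ e.symm) (e q)) :=
    hd.hasFDerivAt.hasMFDerivAt
  refine (h2.comp q h1).congr_of_eventuallyEq ?_
  filter_upwards [e.open_source.mem_nhds hq] with z hz
  simp [e.left_inv hz]

theorem mvfderiv_chart (he : e ∈ atlas E2 M) (hq : q ∈ e.source) {h : M → G}
    (hd : DifferentiableAt ℝ (h ∘ e.symm) (e q)) (v : TangentSpace (𝓡 2) q) :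
    mvfderiv (𝓡 2) h q v = fderiv ℝ (h ∘ e.symm) (e q) (dch e q v) := by
  have := (hasMFDerivAt_chart he hq hd).mfderiv
  rw [mvfderiv, this]
  rfl

theorem smooth_chart (he : e ∈ atlas E2 M) {h : M → G} (hh : ContMDiff (𝓡 2) 𝓘(ℝ, G) ∞ h) :
    ContDiffOn ℝ ∞ (h ∘ e.symm) e.target := by
  have h1 : ContMDiffOn (𝓡 2) (𝓡 2) ∞ e.symm e.target :=
    contMDiffOn_symm_of_mem_maximalAtlas (IsManifold.subset_maximalAtlas he)
  exact contMDiffOn_iff_contDiffOn.1 (hh.comp_contMDiffOn h1)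

end Charts

/-! ### The surface read in an arbitrary chart -/

namespace IsPNMCBiconservative

variable {M : Type*} [TopologicalSpace M] [ChartedSpace E2 M] [IsManifold (𝓡 2) ∞ M]
  {Φ : M → R51} {e : OpenPartialHomeomorph M E2} {q : M}

theorem smooth_X (hΦ : IsPNMCBiconservative Φ) (he : e ∈ atlas E2 M) :
    ContDiffOn ℝ ∞ (Φ ∘ e.symm) e.target := smooth_chart he hΦ.smooth

theorem mvfderiv_X (hΦ : IsPNMCBiconservative Φ) (he : e ∈ atlas E2 M) (hq : q ∈ e.source)
    (v : TangentSpace (𝓡 2) q) :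
    mvfderiv (𝓡 2) Φ q v = fderiv ℝ (Φ ∘ e.symm) (e q) (dch e q v) :=
  mvfderiv_chart he hq (differentiableAt_of_smooth e.open_target (hΦ.smooth_X he) (e.map_source hq))
    v

theorem isParam (hΦ : IsPNMCBiconservative Φ) (he : e ∈ atlas E2 M) :
    IsParam e.target (Φ ∘ e.symm) where
  isOpen := e.open_target
  smooth := hΦ.smooth_X he
  mem x _ := hΦ.mem_H4 _
  inj x hx := by
    intro u v huv
    obtain ⟨u, rfl⟩ := dch_surjective he (e.map_target hx) u
    obtain ⟨v, rfl⟩ := dch_surjective he (e.map_target hx) v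
    have h := fun u => hΦ.mvfderiv_X he (e.map_target hx) u
    rw [e.right_inv hx] at h
    rw [← h, ← h] at huv
    rw [hΦ.immersion _ huv]

theorem mink_mvfderiv (hΦ : IsPNMCBiconservative Φ) (q : M) (v : TangentSpace (𝓡 2) q) :
    mink (mvfderiv (𝓡 2) Φ q v) (Φ q) = 0 := by
  have he := chart_mem_atlas E2 q
  have hq := mem_chart_source E2 q
  have := (hΦ.isParam he).mink_fderiv ((chartAt E2 q).map_source hq) (dch (chartAt E2 q) q v)
  rw [hΦ.mvfderiv_X he hq]
  simpa [(chartAt E2 q).left_inv hq] using this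

theorem indMetric_pos (hΦ : IsPNMCBiconservative Φ) (q : M) {v : TangentSpace (𝓡 2) q}
    (hv : v ≠ 0) : 0 < indMetric Φ q v v := by
  refine mink_self_pos (hΦ.mem_H4 q) (hΦ.mink_mvfderiv q v) fun h => hv ?_
  exact hΦ.immersion q (by rw [h, map_zero])

theorem unit_vE1 (hΦ : IsPNMCBiconservative Φ) (q : M) :
    indMetric Φ q (vE1 Φ q) (vE1 Φ q) = 1 := by
  have h := hΦ.indMetric_pos q (hΦ.grad_ne_zero q)
  set r := indMetric Φ q (grad Φ (meanCurv Φ) q) (grad Φ (meanCurv Φ) q) with hr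
  have : indMetric Φ q (vE1 Φ q) (vE1 Φ q) = (Real.sqrt r)⁻¹ * ((Real.sqrt r)⁻¹ * r) := by
    simp only [indMetric, vE1, map_smul, mink_smul_left, mink_smul_right, hr]
  rw [this, ← mul_assoc, ← mul_inv, Real.mul_self_sqrt h.le, inv_mul_cancel₀ h.ne']

variable {vE2 : (p : M) → TangentSpace (𝓡 2) p} {vE4 : M → R51}

/-- The mean curvature vector can be computed in any chart. -/
theorem meanCurvVec_chart (hΦ : IsPNMCBiconservative Φ) (hE2 : IsE2 Φ vE2) (he : e ∈ atlas E2 M)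
    (hq : q ∈ e.source) : meanCurvVec Φ q = (1 / 2 : ℝ) • tension (Φ ∘ e.symm) (e q) := by
  have he' := chart_mem_atlas E2 q
  have hq' := mem_chart_source E2 q
  set e' := chartAt E2 q
  -- The definition uses the preferred chart at `q`; the transition map from `e` to it is the
  -- reparametrization to which `tension_comp` applies, with $E_1,E_2$ as orthonormal basis.
  have hψ : ContDiffAt ℝ ∞ (e' ∘ e.symm) (e q) := by
    have h1 : ContMDiffAt (𝓡 2) (𝓡 2) ∞ e.symm (e q) :=
      contMDiffAt_symm_of_mem_maximalAtlas (IsManifold.subset_maximalAtlas he) (e.map_source hq)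
    have h2 : ContMDiffAt (𝓡 2) (𝓡 2) ∞ e' (e.symm (e q)) :=
      contMDiffAt_of_mem_maximalAtlas (IsManifold.subset_maximalAtlas he')
        (by rw [e.left_inv hq]; exact hq')
    exact contMDiffAt_iff_contDiffAt.1 (h2.comp (e q) h1)
  have hψy : (e' ∘ e.symm) (e q) = e' q := by simp [e.left_inv hq]
  have hYX : Φ ∘ e.symm =ᶠ[nhds (e q)] (Φ ∘ e'.symm) ∘ (e' ∘ e.symm) := by
    have hc : ContinuousAt e.symm (e q) := e.continuousAt_symm (e.map_source hq)
    have := hc.preimage_mem_nhds (e'.open_source.mem_nhds (by rw [e.left_inv hq]; exact hq'))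
    filter_upwards [this] with z hz
    simp only [Function.comp_apply]
    rw [e'.left_inv hz]
  have h11 := hΦ.unit_vE1 q
  have h12 := hE2.orth q
  have h22 := hE2.unit q
  simp only [indMetric, hΦ.mvfderiv_X he hq] at h11 h12 h22
  rw [meanCurvVec, (hΦ.isParam he').tension_comp (hΦ.isParam he) (e.map_source hq) hψ
    (by rw [hψy]; exact e'.map_source hq') hYX h11 h12 h22, hψy]

end IsPNMCBiconservative

namespace IsPNMCBiconservative

variable {M : Type*} [TopologicalSpace M] [ChartedSpace E2 M]
  {Φ : M → R51} {e : OpenPartialHomeomorph M E2} {q : M}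
  {vE2 : (p : M) → TangentSpace (𝓡 2) p} {vE4 : M → R51}

theorem mink_meanCurvVec (hΦ : IsPNMCBiconservative Φ) (q : M) :
    mink (meanCurvVec Φ q) (meanCurvVec Φ q) = meanCurv Φ q ^ 2 := by
  have h := hΦ.meanCurv_pos q
  rw [meanCurv] at h ⊢
  rw [Real.sq_sqrt (Real.sqrt_pos.1 h).le]

/-- The coordinates of a vector field in the chart `e`. -/
noncomputable def coordField (e : OpenPartialHomeomorph M E2) (v : (p : M) → TangentSpace (𝓡 2) p)
    (x : E2) : E2 := dch e (e.symm x) (v (e.symm x))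

theorem coordField_apply (v : (p : M) → TangentSpace (𝓡 2) p) (hq : q ∈ e.source) :
    coordField e v (e q) = dch e q (v q) :=
  congrArg (fun p => dch e p (v p)) (e.left_inv hq)

variable [IsManifold (𝓡 2) ∞ M]

/-- The definition uses a chart that changes from point to point, so smoothness becomes visible only
after rewriting in one fixed chart. -/
theorem smooth_meanCurvVec (hΦ : IsPNMCBiconservative Φ) (hE2 : IsE2 Φ vE2) (he : e ∈ atlas E2 M) :
    ContDiffOn ℝ ∞ (meanCurvVec Φ ∘ e.symm) e.target := by
  refine (contDiffOn_const.smul (hΦ.isParam he).smooth_tension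
    (f := fun _ => (1 / 2 : ℝ))).congr fun x hx => ?_
  rw [Function.comp_apply, hΦ.meanCurvVec_chart hE2 he (e.map_target hx), e.right_inv hx]
  rfl

theorem smooth_meanCurv (hΦ : IsPNMCBiconservative Φ) (hE2 : IsE2 Φ vE2) (he : e ∈ atlas E2 M) :
    ContDiffOn ℝ ∞ (meanCurv Φ ∘ e.symm) e.target := by
  have h := hΦ.smooth_meanCurvVec hE2 he
  refine (contDiffOn_mink h h).sqrt fun x _ => ?_
  simp only [Function.comp_apply]
  rw [hΦ.mink_meanCurvVec]
  exact (pow_pos (hΦ.meanCurv_pos _) 2).ne'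

theorem smooth_vE3 (hΦ : IsPNMCBiconservative Φ) (hE2 : IsE2 Φ vE2) (he : e ∈ atlas E2 M) :
    ContDiffOn ℝ ∞ (vE3 Φ ∘ e.symm) e.target :=
  ((hΦ.smooth_meanCurv hE2 he).inv fun _ _ => (hΦ.meanCurv_pos _).ne').smul
    (hΦ.smooth_meanCurvVec hE2 he)

/-- The mean curvature function is differentiable, with derivative computed in any chart. -/
theorem mvfderiv_meanCurv (hΦ : IsPNMCBiconservative Φ) (hE2 : IsE2 Φ vE2) (he : e ∈ atlas E2 M)
    (hq : q ∈ e.source) (v : TangentSpace (𝓡 2) q) :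
    mvfderiv (𝓡 2) (meanCurv Φ) q v = fderiv ℝ (meanCurv Φ ∘ e.symm) (e q) (dch e q v) :=
  mvfderiv_chart he hq (differentiableAt_of_smooth e.open_target (hΦ.smooth_meanCurv hE2 he)
    (e.map_source hq)) v

theorem grad_pairing (hΦ : IsPNMCBiconservative Φ) (hE2 : IsE2 Φ vE2) (q : M)
    (w : TangentSpace (𝓡 2) q) :
    indMetric Φ q (grad Φ (meanCurv Φ) q) w = mvfderiv (𝓡 2) (meanCurv Φ) q w := by
  have he := chart_mem_atlas E2 q
  have hq := mem_chart_source E2 q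
  have P := hΦ.isParam he
  have hd : ∀ v : TangentSpace (𝓡 2) q, mvfderiv (𝓡 2) Φ q v =
      fderiv ℝ (Φ ∘ (chartAt E2 q).symm) (chartAt E2 q q) v := fun v => by
    rw [hΦ.mvfderiv_X he hq, dch_self]
  have hf : ∀ v : TangentSpace (𝓡 2) q, mvfderiv (𝓡 2) (meanCurv Φ) q v =
      fderiv ℝ (meanCurv Φ ∘ (chartAt E2 q).symm) (chartAt E2 q q) v := fun v => by
    rw [hΦ.mvfderiv_meanCurv hE2 he hq, dch_self]
  have hg : grad Φ (meanCurv Φ) q = IsParam.gradVec (Φ ∘ (chartAt E2 q).symm)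
      (meanCurv Φ ∘ (chartAt E2 q).symm) (chartAt E2 q q) := by
    unfold grad IsParam.gradVec
    simp only [indMetric, hd, hf]
    rfl
  rw [indMetric, hd, hd, hf, hg]
  exact P.gradVec_pairing ((chartAt E2 q).map_source hq) _ w

/-- The gradient of the mean curvature function in a chart. -/
theorem dch_grad (hΦ : IsPNMCBiconservative Φ) (hE2 : IsE2 Φ vE2) (he : e ∈ atlas E2 M)
    (hq : q ∈ e.source) : dch e q (grad Φ (meanCurv Φ) q) =
      IsParam.gradVec (Φ ∘ e.symm) (meanCurv Φ ∘ e.symm) (e q) := by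
  have P := hΦ.isParam he
  refine P.eq_of_tangent (e.map_source hq) fun w => ?_
  obtain ⟨w, rfl⟩ := dch_surjective he hq w
  rw [P.gradVec_pairing (e.map_source hq), ← hΦ.mvfderiv_X he hq, ← hΦ.mvfderiv_X he hq,
    ← hΦ.mvfderiv_meanCurv hE2 he hq]
  exact hΦ.grad_pairing hE2 q w

theorem fderiv_coordField (hΦ : IsPNMCBiconservative Φ) (he : e ∈ atlas E2 M)
    (v : (p : M) → TangentSpace (𝓡 2) p) {x : E2} (hx : x ∈ e.target) :
    fderiv ℝ (Φ ∘ e.symm) x (coordField e v x) =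
      ((fun p => mvfderiv (𝓡 2) Φ p (v p)) ∘ e.symm) x := by
  have := hΦ.mvfderiv_X he (e.map_target hx) (v (e.symm x))
  rw [e.right_inv hx] at this
  exact this.symm

theorem smooth_coord_vE1 (hΦ : IsPNMCBiconservative Φ) (hE2 : IsE2 Φ vE2) (he : e ∈ atlas E2 M) :
    ContDiffOn ℝ ∞ (coordField e (vE1 Φ)) e.target := by
  have P := hΦ.isParam he
  have sg := P.smooth_gradVec (hΦ.smooth_meanCurv hE2 he)
  have sD := (P.smooth.fderiv_of_isOpen P.isOpen (m := ∞) (by simp)).clm_apply sg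
  have hpos : ∀ x ∈ e.target, indMetric Φ (e.symm x) (grad Φ (meanCurv Φ) (e.symm x))
      (grad Φ (meanCurv Φ) (e.symm x)) = mink (fderiv ℝ (Φ ∘ e.symm) x
        (IsParam.gradVec (Φ ∘ e.symm) (meanCurv Φ ∘ e.symm) x)) (fderiv ℝ (Φ ∘ e.symm) x
        (IsParam.gradVec (Φ ∘ e.symm) (meanCurv Φ ∘ e.symm) x)) := fun x hx => by
    rw [indMetric, hΦ.mvfderiv_X he (e.map_target hx), hΦ.dch_grad hE2 he (e.map_target hx),
      e.right_inv hx]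
  have hn : ∀ x ∈ e.target, Real.sqrt (mink (fderiv ℝ (Φ ∘ e.symm) x
        (IsParam.gradVec (Φ ∘ e.symm) (meanCurv Φ ∘ e.symm) x)) (fderiv ℝ (Φ ∘ e.symm) x
        (IsParam.gradVec (Φ ∘ e.symm) (meanCurv Φ ∘ e.symm) x))) ≠ 0 := fun x hx => by
    rw [← hpos x hx]
    exact (Real.sqrt_pos.2 (hΦ.indMetric_pos _ (hΦ.grad_ne_zero _))).ne'
  refine ((((contDiffOn_mink sD sD).sqrt fun x hx => ?_).inv hn).smul sg).congr fun x hx => ?_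
  · rw [← hpos x hx]
    exact (hΦ.indMetric_pos _ (hΦ.grad_ne_zero _)).ne'
  · rw [coordField, vE1, dch_smul, hpos x hx, hΦ.dch_grad hE2 he (e.map_target hx),
      e.right_inv hx]
    rfl

/-- The hypothesis concerns the $\mathbb R^5_1$-valued field $dX(E_2)$; pairing it with
$\partial_jX$ and applying the inverse metric recovers smooth coordinates. -/
theorem smooth_coord_vE2 (hΦ : IsPNMCBiconservative Φ) (hE2 : IsE2 Φ vE2) (he : e ∈ atlas E2 M) :
    ContDiffOn ℝ ∞ (coordField e vE2) e.target := by
  have P := hΦ.isParam he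
  refine (P.smooth_tangentVec (smooth_chart he hE2.smooth)).congr fun x hx => ?_
  rw [← hΦ.fderiv_coordField he vE2 hx, P.tangentVec_fderiv hx]

/-- `E₁, …, E₄` together with the position vector form a frame. -/
theorem isFrame (hΦ : IsPNMCBiconservative Φ) (hE2 : IsE2 Φ vE2) (hE4 : IsE4 Φ vE4) (q : M) :
    IsFrame (Φ q) (mvfderiv (𝓡 2) Φ q (vE1 Φ q)) (mvfderiv (𝓡 2) Φ q (vE2 q)) (vE3 Φ q)
      (vE4 q) := by
  have he := chart_mem_atlas E2 q
  have hq := mem_chart_source E2 q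
  have P := hΦ.isParam he
  have hx := (chartAt E2 q).map_source hq
  have hH := hΦ.meanCurvVec_chart hE2 he hq
  have f0 := hΦ.meanCurv_pos q
  have hHn : ∀ v : TangentSpace (𝓡 2) q, mink (vE3 Φ q) (mvfderiv (𝓡 2) Φ q v) = 0 := fun v => by
    rw [vE3, hH, hΦ.mvfderiv_X he hq, mink_smul_left, mink_smul_left, P.tension_tangent hx]
    simp
  have hHq : mink (vE3 Φ q) (Φ q) = 0 := by
    have := P.tension_self hx
    rw [Function.comp_apply, (chartAt E2 q).left_inv hq] at this
    rw [vE3, hH, mink_smul_left, mink_smul_left, this]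
    simp
  refine ⟨(hΦ.mem_H4 q).1, ?_, ?_, ?_, ?_, hΦ.unit_vE1 q, hE2.orth q, ?_, ?_, hE2.unit q, ?_, ?_,
    ?_, hE4.orth q, hE4.unit q⟩
  · rw [mink_comm]; exact hΦ.mink_mvfderiv q _
  · rw [mink_comm]; exact hΦ.mink_mvfderiv q _
  · rw [mink_comm]; exact hHq
  · rw [mink_comm]; exact (hE4.normal q).1
  · rw [mink_comm]; exact hHn _
  · rw [mink_comm]; exact (hE4.normal q).2 _
  · rw [mink_comm]; exact hHn _
  · rw [mink_comm]; exact (hE4.normal q).2 _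
  · rw [vE3, mink_smul_left, mink_smul_right, hΦ.mink_meanCurvVec]
    field_simp

theorem mvfderiv_meanCurv_vE1_pos (hΦ : IsPNMCBiconservative Φ) (hE2 : IsE2 Φ vE2) (q : M) :
    0 < mvfderiv (𝓡 2) (meanCurv Φ) q (vE1 Φ q) := by
  have h := hΦ.indMetric_pos q (hΦ.grad_ne_zero q)
  have hp := hΦ.grad_pairing hE2 q (grad Φ (meanCurv Φ) q)
  rw [vE1, map_smul, ← hp, smul_eq_mul]
  exact mul_pos (inv_pos.2 (Real.sqrt_pos.2 h)) h

theorem mvfderiv_meanCurv_vE2 (hΦ : IsPNMCBiconservative Φ) (hE2 : IsE2 Φ vE2) (q : M) :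
    mvfderiv (𝓡 2) (meanCurv Φ) q (vE2 q) = 0 := by
  have h := Real.sqrt_pos.2 (hΦ.indMetric_pos q (hΦ.grad_ne_zero q))
  have h2 := hE2.orth q
  rw [vE1, indMetric, map_smul, mink_smul_left] at h2
  rw [← hΦ.grad_pairing hE2]
  exact (mul_eq_zero.1 h2).resolve_left (inv_ne_zero h.ne')

/-- In a chart, the surface satisfies the hypotheses of the local theory. -/
theorem isPNMC_chart (hΦ : IsPNMCBiconservative Φ) (hE2 : IsE2 Φ vE2) (hE4 : IsE4 Φ vE4)
    (he : e ∈ atlas E2 M) :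
    AdaptedFrame.IsPNMC e.target (Φ ∘ e.symm)
      ((fun p => mvfderiv (𝓡 2) Φ p (vE1 Φ p)) ∘ e.symm)
      ((fun p => mvfderiv (𝓡 2) Φ p (vE2 p)) ∘ e.symm) (vE3 Φ ∘ e.symm) (vE4 ∘ e.symm)
      (coordField e (vE1 Φ)) (coordField e vE2) (meanCurv Φ ∘ e.symm) := by
  have P := hΦ.isParam he
  have s1 := hΦ.smooth_coord_vE1 hE2 he
  have A : AdaptedFrame e.target (Φ ∘ e.symm)
      ((fun p => mvfderiv (𝓡 2) Φ p (vE1 Φ p)) ∘ e.symm)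
      ((fun p => mvfderiv (𝓡 2) Φ p (vE2 p)) ∘ e.symm) (vE3 Φ ∘ e.symm) (vE4 ∘ e.symm)
      (coordField e (vE1 Φ)) (coordField e vE2) :=
    { isOpen := e.open_target
      sX := P.smooth
      s1 := (smooth_dir P.isOpen P.smooth s1).congr fun x hx =>
        (hΦ.fderiv_coordField he _ hx).symm
      s2 := smooth_chart he hE2.smooth
      s3 := hΦ.smooth_vE3 hE2 he
      s4 := smooth_chart he hE4.smooth
      sa := s1
      sb := hΦ.smooth_coord_vE2 hE2 he
      frame := fun x _ => hΦ.isFrame hE2 hE4 _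
      dXa := fun x hx => hΦ.fderiv_coordField he _ hx
      dXb := fun x hx => hΦ.fderiv_coordField he _ hx }
  refine A.isPNMC P (hΦ.smooth_meanCurv hE2 he) (fun x _ => hΦ.meanCurv_pos _) ?_ ?_ ?_ ?_ ?_
  · intro x hx
    have h := hΦ.mvfderiv_meanCurv hE2 he (e.map_target hx) (vE1 Φ (e.symm x))
    rw [e.right_inv hx] at h
    exact (hΦ.mvfderiv_meanCurv_vE1_pos hE2 _).trans_eq h
  · intro x hx
    have h := hΦ.mvfderiv_meanCurv hE2 he (e.map_target hx) (vE2 (e.symm x))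
    rw [e.right_inv hx] at h
    exact h.symm.trans (hΦ.mvfderiv_meanCurv_vE2 hE2 _)
  · intro x hx v
    obtain ⟨v, rfl⟩ := dch_surjective he (e.map_target hx) v
    have h := mvfderiv_chart he (e.map_target hx) (h := vE3 Φ) (differentiableAt_of_smooth
      e.open_target (hΦ.smooth_vE3 hE2 he) (by rw [e.right_inv hx]; exact hx)) v
    rw [e.right_inv hx] at h
    rw [← h]
    exact hΦ.parallel _ _ _ (hE4.normal _)
  · intro x hx
    have h := hΦ.meanCurvVec_chart hE2 he (e.map_target hx)
    rw [e.right_inv hx] at h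
    have f0 := (hΦ.meanCurv_pos (e.symm x)).ne'
    simp only [Function.comp_apply, vE3]
    rw [h, smul_smul, smul_smul]
    field_simp
    simp
  · intro x hx w
    rw [fderiv_eq_pd]
    simp [hΦ.biconservative e he x hx]

end IsPNMCBiconservative

/-! ### Functions and frame fields on the whole surface -/

section ChartSmooth

variable {M : Type*} [TopologicalSpace M] [ChartedSpace E2 M]
  {G : Type*} [NormedAddCommGroup G] [NormedSpace ℝ G] {h : M → G}
  {e : OpenPartialHomeomorph M E2} {x : E2}

/-- `h` is smooth in every chart of the atlas. -/
def ChartSmooth (h : M → G) : Prop := ∀ e ∈ atlas E2 M, ContDiffOn ℝ ∞ (h ∘ e.symm) e.target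

/-- The field `dΦ(v)`, as a map to `ℝ⁵₁`. -/
noncomputable def tanVec (Φ : M → R51) (v : (p : M) → TangentSpace (𝓡 2) p) (p : M) : R51 :=
  mvfderiv (𝓡 2) Φ p (v p)

theorem exists_chart_point (q : M) : ∃ e ∈ atlas E2 M, ∃ x ∈ e.target, e.symm x = q :=
  ⟨chartAt E2 q, chart_mem_atlas E2 q, chartAt E2 q q,
    (chartAt E2 q).map_source (mem_chart_source E2 q),
    (chartAt E2 q).left_inv (mem_chart_source E2 q)⟩

variable [IsManifold (𝓡 2) ∞ M]

theorem ChartSmooth.mvfderiv_eq_dir (hh : ChartSmooth h) (he : e ∈ atlas E2 M) (hx : x ∈ e.target)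
    (v : (p : M) → TangentSpace (𝓡 2) p) :
    mvfderiv (𝓡 2) h (e.symm x) (v (e.symm x)) =
      dir (IsPNMCBiconservative.coordField e v) (h ∘ e.symm) x := by
  have := mvfderiv_chart he (e.map_target hx) (differentiableAt_of_smooth e.open_target (hh e he)
    (by rw [e.right_inv hx]; exact hx)) (v (e.symm x))
  rw [e.right_inv hx] at this
  exact this

theorem ChartSmooth.hasMFDerivAt (hh : ChartSmooth h) (q : M) :
    HasMFDerivAt (𝓡 2) 𝓘(ℝ, G) h q (mfderiv (𝓡 2) 𝓘(ℝ, G) h q) :=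
  (hasMFDerivAt_chart (chart_mem_atlas E2 q) (mem_chart_source E2 q)
    (differentiableAt_of_smooth (chartAt E2 q).open_target (hh _ (chart_mem_atlas E2 q))
      ((chartAt E2 q).map_source (mem_chart_source E2 q)))).mdifferentiableAt.hasMFDerivAt

end ChartSmooth

namespace IsPNMCBiconservative

variable {M : Type*} [TopologicalSpace M] [ChartedSpace E2 M] [IsManifold (𝓡 2) ∞ M]
  {Φ : M → R51} {e : OpenPartialHomeomorph M E2} {q : M}
  {vE2 : (p : M) → TangentSpace (𝓡 2) p} {vE4 : M → R51}

/-- A function whose derivatives along `E₁` and `E₂` vanish is constant. -/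
theorem const_of_derivs (hΦ : IsPNMCBiconservative Φ) (hE2 : IsE2 Φ vE2) (hE4 : IsE4 Φ vE4)
    [PreconnectedSpace M] {G : Type*} [NormedAddCommGroup G] [NormedSpace ℝ G] {h : M → G}
    (hh : ChartSmooth h) (h1 : ∀ q, mvfderiv (𝓡 2) h q (vE1 Φ q) = 0)
    (h2 : ∀ q, mvfderiv (𝓡 2) h q (vE2 q) = 0) (p q : M) : h p = h q := by
  suffices hl : IsLocallyConstant h from hl.apply_eq_of_preconnectedSpace p q
  rw [IsLocallyConstant.iff_eventually_eq]
  intro p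
  have he := chart_mem_atlas E2 p
  have hp := mem_chart_source E2 p
  set e := chartAt E2 p
  have A := hΦ.isPNMC_chart hE2 hE4 he
  have hd : ∀ x ∈ e.target, fderiv ℝ (h ∘ e.symm) x = 0 := fun x hx => by
    ext w
    obtain ⟨α, β, rfl⟩ := A.exists_comb hx w
    have e1 := hh.mvfderiv_eq_dir he hx (vE1 Φ)
    have e2 := hh.mvfderiv_eq_dir he hx vE2
    rw [h1] at e1
    rw [h2] at e2
    rw [map_add, map_smul, map_smul]
    change α • dir (coordField e (vE1 Φ)) (h ∘ e.symm) x + β • dir (coordField e vE2) (h ∘ e.symm) x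
      = 0
    rw [← e1, ← e2]; simp
  have ho := e.open_target.isOpen_inter_preimage_of_fderiv_eq_zero
    (fun x hx => (differentiableAt_of_smooth e.open_target (hh e he) hx).differentiableWithinAt)
    (fun x hx => hd x hx) {h p}
  have hmem : e p ∈ e.target ∩ (h ∘ e.symm) ⁻¹' {h p} :=
    ⟨e.map_source hp, by simp [e.left_inv hp]⟩
  filter_upwards [e.open_source.mem_nhds hp,
    (e.continuousAt hp).preimage_mem_nhds (ho.mem_nhds hmem)] with z hz hz'
  have := hz'.2
  simpa [e.left_inv hz] using this

theorem chartSmooth_tanVec_vE1 (hΦ : IsPNMCBiconservative Φ) (hE2 : IsE2 Φ vE2)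
    (hE4 : IsE4 Φ vE4) : ChartSmooth (tanVec Φ (vE1 Φ)) := fun _ he =>
  (hΦ.isPNMC_chart hE2 hE4 he).s1

theorem chartSmooth_meanCurv (hΦ : IsPNMCBiconservative Φ) (hE2 : IsE2 Φ vE2) :
    ChartSmooth (meanCurv Φ) := fun _ he => hΦ.smooth_meanCurv hE2 he

/-- The entry `⟨A₄ E₁, E₁⟩` of the shape operator. -/
noncomputable def shapeCoef (Φ : M → R51) (vE4 : M → R51) (q : M) : ℝ :=
  mink (mvfderiv (𝓡 2) (tanVec Φ (vE1 Φ)) q (vE1 Φ q)) (vE4 q)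

/-- The connection coefficient `⟨∇_{E₂} E₁, E₂⟩`. -/
noncomputable def connCoef (Φ : M → R51) (vE2 : (p : M) → TangentSpace (𝓡 2) p) (q : M) : ℝ :=
  mink (mvfderiv (𝓡 2) (tanVec Φ (vE1 Φ)) q (vE2 q)) (tanVec Φ vE2 q)

theorem shapeCoef_chart (hΦ : IsPNMCBiconservative Φ) (hE2 : IsE2 Φ vE2) (hE4 : IsE4 Φ vE4)
    (he : e ∈ atlas E2 M) : Set.EqOn (shapeCoef Φ vE4 ∘ e.symm) (fun y => mink
      (dir (coordField e (vE1 Φ)) (tanVec Φ (vE1 Φ) ∘ e.symm) y) ((vE4 ∘ e.symm) y)) e.target :=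
  fun x hx => by
    simp only [Function.comp_apply, shapeCoef]
    rw [(hΦ.chartSmooth_tanVec_vE1 hE2 hE4).mvfderiv_eq_dir he hx]

theorem connCoef_chart (hΦ : IsPNMCBiconservative Φ) (hE2 : IsE2 Φ vE2) (hE4 : IsE4 Φ vE4)
    (he : e ∈ atlas E2 M) : Set.EqOn (connCoef Φ vE2 ∘ e.symm) (fun y => mink
      (dir (coordField e vE2) (tanVec Φ (vE1 Φ) ∘ e.symm) y) ((tanVec Φ vE2 ∘ e.symm) y))
      e.target :=
  fun x hx => by
    simp only [Function.comp_apply, connCoef]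
    rw [(hΦ.chartSmooth_tanVec_vE1 hE2 hE4).mvfderiv_eq_dir he hx]

theorem chartSmooth_shapeCoef (hΦ : IsPNMCBiconservative Φ) (hE2 : IsE2 Φ vE2) (hE4 : IsE4 Φ vE4) :
    ChartSmooth (shapeCoef Φ vE4) := fun _ he =>
  have A := hΦ.isPNMC_chart hE2 hE4 he
  (contDiffOn_mink (smooth_dir A.isOpen A.s1 A.sa) A.s4).congr (hΦ.shapeCoef_chart hE2 hE4 he)

theorem chartSmooth_connCoef (hΦ : IsPNMCBiconservative Φ) (hE2 : IsE2 Φ vE2) (hE4 : IsE4 Φ vE4) :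
    ChartSmooth (connCoef Φ vE2) := fun _ he =>
  have A := hΦ.isPNMC_chart hE2 hE4 he
  (contDiffOn_mink (smooth_dir A.isOpen A.s1 A.sb) A.s2).congr (hΦ.connCoef_chart hE2 hE4 he)

/-- The derivatives of the frame fields. -/
theorem frame_derivs (hΦ : IsPNMCBiconservative Φ) (hE2 : IsE2 Φ vE2) (hE4 : IsE4 Φ vE4) (q : M) :
    mvfderiv (𝓡 2) (tanVec Φ (vE1 Φ)) q (vE1 Φ q) =
      Φ q + -meanCurv Φ q • vE3 Φ q + shapeCoef Φ vE4 q • vE4 q ∧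
    mvfderiv (𝓡 2) (tanVec Φ vE2) q (vE1 Φ q) = 0 ∧
    mvfderiv (𝓡 2) (vE3 Φ) q (vE1 Φ q) = meanCurv Φ q • tanVec Φ (vE1 Φ) q ∧
    mvfderiv (𝓡 2) vE4 q (vE1 Φ q) = -shapeCoef Φ vE4 q • tanVec Φ (vE1 Φ) q ∧
    mvfderiv (𝓡 2) vE4 q (vE2 q) = shapeCoef Φ vE4 q • tanVec Φ vE2 q := by
  obtain ⟨e, he, x, hx, rfl⟩ := exists_chart_point q
  have A := hΦ.isPNMC_chart hE2 hE4 he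
  have hk := hΦ.shapeCoef_chart hE2 hE4 he hx
  obtain ⟨D1, D2, D3, D4, -, -, -, D8⟩ := A.frame_derivs hx
  have s1 : ChartSmooth (tanVec Φ (vE1 Φ)) := fun _ he => (hΦ.isPNMC_chart hE2 hE4 he).s1
  have s2 : ChartSmooth (tanVec Φ vE2) := fun _ he => (hΦ.isPNMC_chart hE2 hE4 he).s2
  have s3 : ChartSmooth (vE3 Φ) := fun _ he => (hΦ.isPNMC_chart hE2 hE4 he).s3
  have s4 : ChartSmooth vE4 := fun _ he => (hΦ.isPNMC_chart hE2 hE4 he).s4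
  rw [s1.mvfderiv_eq_dir he hx, s2.mvfderiv_eq_dir he hx, s3.mvfderiv_eq_dir he hx,
    s4.mvfderiv_eq_dir he hx, s4.mvfderiv_eq_dir he hx]
  simp only [Function.comp_apply] at hk
  rw [hk]
  exact ⟨D1, D2, D3, D4, D8⟩

/-- The derivatives of the scalar invariants. -/
theorem scalar_derivs (hΦ : IsPNMCBiconservative Φ) (hE2 : IsE2 Φ vE2) (hE4 : IsE4 Φ vE4) (q : M) :
    mvfderiv (𝓡 2) (meanCurv Φ) q (vE1 Φ q) = -(4 / 3) * meanCurv Φ q * connCoef Φ vE2 q ∧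
    mvfderiv (𝓡 2) (shapeCoef Φ vE4) q (vE1 Φ q) = -2 * shapeCoef Φ vE4 q * connCoef Φ vE2 q ∧
    mvfderiv (𝓡 2) (shapeCoef Φ vE4) q (vE2 q) = 0 ∧
    mvfderiv (𝓡 2) (connCoef Φ vE2) q (vE1 Φ q) =
      1 + 3 * meanCurv Φ q ^ 2 + shapeCoef Φ vE4 q ^ 2 - connCoef Φ vE2 q ^ 2 ∧
    mvfderiv (𝓡 2) (connCoef Φ vE2) q (vE2 q) = 0 := by
  obtain ⟨e, he, x, hx, rfl⟩ := exists_chart_point q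
  have A := hΦ.isPNMC_chart hE2 hE4 he
  have hk := hΦ.shapeCoef_chart hE2 hE4 he
  have hw := hΦ.connCoef_chart hE2 hE4 he
  obtain ⟨D1, D2, D3, D4⟩ := A.gauss_codazzi hx
  have D0 := (A.geodesic hx).2
  have sk := hΦ.chartSmooth_shapeCoef hE2 hE4
  have sw := hΦ.chartSmooth_connCoef hE2 hE4
  rw [(hΦ.chartSmooth_meanCurv hE2).mvfderiv_eq_dir he hx, sk.mvfderiv_eq_dir he hx,
    sk.mvfderiv_eq_dir he hx, sw.mvfderiv_eq_dir he hx, sw.mvfderiv_eq_dir he hx]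
  rw [dir_congr e.open_target hk hx, dir_congr e.open_target hk hx,
    dir_congr e.open_target hw hx, dir_congr e.open_target hw hx]
  have hkx := hk hx
  have hwx := hw hx
  simp only [Function.comp_apply] at hkx hwx
  rw [hkx, hwx]
  exact ⟨D0, D1, D2, D3, D4⟩

/-- The second fundamental form in the direction of `E₄`. -/
theorem secondFF_vE4 (hΦ : IsPNMCBiconservative Φ) (hE2 : IsE2 Φ vE2) (hE4 : IsE4 Φ vE4) (q : M) :
    mink (secondFF Φ q (vE1 Φ q) (vE1 Φ q)) (vE4 q) = shapeCoef Φ vE4 q ∧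
    mink (secondFF Φ q (vE1 Φ q) (vE2 q)) (vE4 q) = 0 ∧
    mink (secondFF Φ q (vE2 q) (vE2 q)) (vE4 q) = -shapeCoef Φ vE4 q := by
  have he := chart_mem_atlas E2 q
  have hq := mem_chart_source E2 q
  have hx := (chartAt E2 q).map_source hq
  have A := hΦ.isPNMC_chart hE2 hE4 he
  have hk := hΦ.shapeCoef_chart hE2 hE4 he hx
  have E : ∀ v w : (p : M) → TangentSpace (𝓡 2) p, secondFF Φ q (v q) (w q) =
      IsParam.sffq (Φ ∘ (chartAt E2 q).symm) (chartAt E2 q q) (coordField (chartAt E2 q) v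
        (chartAt E2 q q)) (coordField (chartAt E2 q) w (chartAt E2 q q)) := fun v w => by
    rw [coordField_apply v hq, coordField_apply w hq, dch_self, dch_self]
    rfl
  have hn := A.sffq_normal (hΦ.isParam he) hx (A.frame _ hx).q4 (A.normal_four hx)
  have hs := A.shape_four hx
  have D2 := (A.frame_derivs hx).2.1
  simp only [Function.comp_apply, (chartAt E2 q).left_inv hq] at hk
  have h4 : (vE4 ∘ (chartAt E2 q).symm) (chartAt E2 q q) = vE4 q :=
    congrArg vE4 ((chartAt E2 q).left_inv hq)
  rw [h4] at hn hs
  rw [E, E, E, hn.1, hn.2.1, hn.2.2, hs.2, D2, mink_zero_left, hk]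
  exact ⟨rfl, rfl, rfl⟩

end IsPNMCBiconservative

/-! ### The constants $c$ and $C$ -/

theorem exists_hyperplane {v : R51} (hv : v ≠ 0) :
    ∃ P : Submodule ℝ R51, Module.finrank ℝ P = 4 ∧ ∀ x, x ∈ P ↔ mink x v = 0 := by
  let L : R51 →ₗ[ℝ] ℝ := (minkL v).toLinearMap
  have hL : L ≠ 0 := fun h => hv (eq_zero_of_mink v fun w => congrArg (fun f => f w) h)
  refine ⟨LinearMap.ker L, ?_, fun x => ?_⟩
  · have h := LinearMap.finrank_range_add_finrank_ker L
    rw [LinearMap.range_eq_top.2 (LinearMap.surjective hL)] at h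
    simp at h
    omega
  · rw [LinearMap.mem_ker, mink_comm]; rfl

theorem isTotallyGeodesic_of_mem {P : Submodule ℝ R51} (h : Module.finrank ℝ P = 4) {x : R51}
    (hx : x ∈ H4) (hxP : x ∈ P) : IsTotallyGeodesicH3 (H4 ∩ (P : Set R51)) :=
  ⟨P, h, rfl, x, hx, hxP⟩

theorem dir_rpow {U : Set E2} (hU : IsOpen U) {a : E2 → E2} {f : E2 → ℝ} (hf : ContDiffOn ℝ ∞ f U)
    (hpos : ∀ x ∈ U, 0 < f x) {x : E2} (hx : x ∈ U) (p : ℝ) :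
    dir a (fun y => f y ^ p) x = p * (f x ^ p / f x) * dir a f x := by
  have h := ((differentiableAt_of_smooth hU hf hx).hasFDerivAt.rpow_const (p := p)
    (Or.inl (hpos x hx).ne')).fderiv
  simp only [dir]
  rw [h, Real.rpow_sub_one (hpos x hx).ne']
  rfl

namespace IsPNMCBiconservative

variable {M : Type*} [TopologicalSpace M] [ChartedSpace E2 M] [IsManifold (𝓡 2) ∞ M]
  {Φ : M → R51} {vE2 : (p : M) → TangentSpace (𝓡 2) p} {vE4 : M → R51}

/-- Along $E_1$ the logarithmic derivatives of $k$ and $f$ are $-2w$ and $-\frac43w$ wherever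
$k\ne0$, which explains the exponent $\frac32$; along $E_2$ both functions are constant. -/
theorem exists_shape_const [ConnectedSpace M] (hΦ : IsPNMCBiconservative Φ) (hE2 : IsE2 Φ vE2)
    (hE4 : IsE4 Φ vE4) :
    ∃ c : ℝ, c ≠ 0 ∧ ∀ q, shapeCoef Φ vE4 q = c * meanCurv Φ q ^ (3 / 2 : ℝ) := by
  have sf := hΦ.chartSmooth_meanCurv hE2
  have sk := hΦ.chartSmooth_shapeCoef hE2 hE4
  set h : M → ℝ := fun p => shapeCoef Φ vE4 p * meanCurv Φ p ^ (-(3 / 2) : ℝ) with hh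
  have srp : ∀ e ∈ atlas E2 M, ContDiffOn ℝ ∞
      (fun y => (meanCurv Φ ∘ e.symm) y ^ (-(3 / 2) : ℝ)) e.target := fun e he =>
    (sf e he).rpow_const_of_ne fun x _ => (hΦ.meanCurv_pos _).ne'
  have sh : ChartSmooth h := fun e he => (sk e he).mul (srp e he)
  have hder : ∀ (v : (p : M) → TangentSpace (𝓡 2) p) (q : M), mvfderiv (𝓡 2) h q (v q) =
      meanCurv Φ q ^ (-(3 / 2) : ℝ) * (mvfderiv (𝓡 2) (shapeCoef Φ vE4) q (v q) - 3 / 2 *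
        shapeCoef Φ vE4 q / meanCurv Φ q * mvfderiv (𝓡 2) (meanCurv Φ) q (v q)) := fun v q => by
    obtain ⟨e, he, x, hx, rfl⟩ := exists_chart_point q
    rw [sh.mvfderiv_eq_dir he hx, sk.mvfderiv_eq_dir he hx, sf.mvfderiv_eq_dir he hx]
    change dir _ (fun y => (shapeCoef Φ vE4 ∘ e.symm) y *
      (meanCurv Φ ∘ e.symm) y ^ (-(3 / 2) : ℝ)) x = _
    rw [dir_mul e.open_target (sk e he) (srp e he) hx,
      dir_rpow e.open_target (sf e he) (fun x _ => hΦ.meanCurv_pos _) hx]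
    simp only [Function.comp_apply]
    ring
  have hconst := hΦ.const_of_derivs hE2 hE4 sh
    (fun q => by
      obtain ⟨d1, d2, -, -, -⟩ := hΦ.scalar_derivs hE2 hE4 q
      have f0 := (hΦ.meanCurv_pos q).ne'
      rw [hder, d1, d2]; field_simp; ring)
    (fun q => by
      obtain ⟨-, -, d3, -, -⟩ := hΦ.scalar_derivs hE2 hE4 q
      rw [hder, d3, hΦ.mvfderiv_meanCurv_vE2 hE2]; ring)
  obtain ⟨p₀⟩ : Nonempty M := inferInstance
  have hk : ∀ q, shapeCoef Φ vE4 q = h p₀ * meanCurv Φ q ^ (3 / 2 : ℝ) := fun q => by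
    rw [hconst p₀ q, hh]
    simp only
    rw [Real.rpow_neg (hΦ.meanCurv_pos q).le, mul_assoc,
      inv_mul_cancel₀ (Real.rpow_pos_of_pos (hΦ.meanCurv_pos q) _).ne', mul_one]
  refine ⟨h p₀, fun h0 => ?_, hk⟩
  have hk0 : ∀ q, shapeCoef Φ vE4 q = 0 := fun q => by rw [hk, h0, zero_mul]
  have s4 : ChartSmooth vE4 := fun _ he => (hΦ.isPNMC_chart hE2 hE4 he).s4
  -- With $k=0$ both derivatives of $E_4$ vanish, so $E_4$ is one fixed vector and the surface lies
  -- in its orthogonal hyperplane, against fullness.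
  have hc4 := hΦ.const_of_derivs hE2 hE4 s4
    (fun q => by rw [(hΦ.frame_derivs hE2 hE4 q).2.2.2.1, hk0]; simp)
    (fun q => by rw [(hΦ.frame_derivs hE2 hE4 q).2.2.2.2, hk0]; simp)
  have hne : vE4 p₀ ≠ 0 := fun hz => by
    have := hE4.unit p₀
    rw [hz, mink_zero_left] at this
    exact zero_ne_one this
  obtain ⟨P, hP, hmem⟩ := exists_hyperplane hne
  have hin : ∀ q, Φ q ∈ P := fun q => by
    rw [hmem, hc4 p₀ q]; exact (hΦ.isFrame hE2 hE4 q).q4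
  exact hΦ.full Set.univ isOpen_univ Set.univ_nonempty _
    (isTotallyGeodesic_of_mem hP (hΦ.mem_H4 p₀) (hin p₀)) fun q _ => ⟨hΦ.mem_H4 q, hin q⟩

/-- For $Q=w^2+9f^2+k^2-1$ the scalar equations give $E_1Q=-2wQ$, the same linear equation that
$f^{3/2}$ satisfies. Hence $Qf^{-3/2}$ is constant; its value is $9C$. -/
theorem exists_first_integral [PreconnectedSpace M] (hΦ : IsPNMCBiconservative Φ)
    (hE2 : IsE2 Φ vE2) (hE4 : IsE4 Φ vE4) :
    ∃ C : ℝ, ∀ q, connCoef Φ vE2 q ^ 2 = 1 + 9 * C * meanCurv Φ q ^ (3 / 2 : ℝ)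
      - 9 * meanCurv Φ q ^ 2 - shapeCoef Φ vE4 q ^ 2 := by
  have sf := hΦ.chartSmooth_meanCurv hE2
  have sk := hΦ.chartSmooth_shapeCoef hE2 hE4
  have sw := hΦ.chartSmooth_connCoef hE2 hE4
  set h : M → ℝ := fun p => (connCoef Φ vE2 p * connCoef Φ vE2 p + (9 * meanCurv Φ p * meanCurv Φ p
    + (shapeCoef Φ vE4 p * shapeCoef Φ vE4 p + -1))) * meanCurv Φ p ^ (-(3 / 2) : ℝ) with hh
  have srp : ∀ e ∈ atlas E2 M, ContDiffOn ℝ ∞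
      (fun y => (meanCurv Φ ∘ e.symm) y ^ (-(3 / 2) : ℝ)) e.target := fun e he =>
    (sf e he).rpow_const_of_ne fun x _ => (hΦ.meanCurv_pos _).ne'
  have s9 : ∀ e ∈ atlas E2 M, ContDiffOn ℝ ∞ (fun y => 9 * (meanCurv Φ ∘ e.symm) y) e.target :=
    fun e he => contDiffOn_const.mul (sf e he)
  have sh1 : ∀ e ∈ atlas E2 M, ContDiffOn ℝ ∞ (fun y => (shapeCoef Φ vE4 ∘ e.symm) y *
      (shapeCoef Φ vE4 ∘ e.symm) y + -1) e.target := fun e he =>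
    ((sk e he).mul (sk e he)).add contDiffOn_const
  have sh2 : ∀ e ∈ atlas E2 M, ContDiffOn ℝ ∞ (fun y => 9 * (meanCurv Φ ∘ e.symm) y *
      (meanCurv Φ ∘ e.symm) y + ((shapeCoef Φ vE4 ∘ e.symm) y *
      (shapeCoef Φ vE4 ∘ e.symm) y + -1)) e.target := fun e he =>
    ((s9 e he).mul (sf e he)).add (sh1 e he)
  have sh3 : ∀ e ∈ atlas E2 M, ContDiffOn ℝ ∞ (fun y => (connCoef Φ vE2 ∘ e.symm) y *
      (connCoef Φ vE2 ∘ e.symm) y + (9 * (meanCurv Φ ∘ e.symm) y *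
      (meanCurv Φ ∘ e.symm) y + ((shapeCoef Φ vE4 ∘ e.symm) y *
      (shapeCoef Φ vE4 ∘ e.symm) y + -1))) e.target := fun e he =>
    ((sw e he).mul (sw e he)).add (sh2 e he)
  have sh : ChartSmooth h := fun e he => (sh3 e he).mul (srp e he)
  have hder : ∀ (v : (p : M) → TangentSpace (𝓡 2) p) (q : M), mvfderiv (𝓡 2) h q (v q) =
      meanCurv Φ q ^ (-(3 / 2) : ℝ) * (2 * connCoef Φ vE2 q *
        mvfderiv (𝓡 2) (connCoef Φ vE2) q (v q) + 18 * meanCurv Φ q *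
        mvfderiv (𝓡 2) (meanCurv Φ) q (v q) + 2 * shapeCoef Φ vE4 q *
        mvfderiv (𝓡 2) (shapeCoef Φ vE4) q (v q) - 3 / 2 * (connCoef Φ vE2 q ^ 2 +
        9 * meanCurv Φ q ^ 2 + shapeCoef Φ vE4 q ^ 2 - 1)
         / meanCurv Φ q * mvfderiv (𝓡 2) (meanCurv Φ) q (v q)) := fun v q => by
    obtain ⟨e, he, x, hx, rfl⟩ := exists_chart_point q
    have ho := e.open_target
    rw [sh.mvfderiv_eq_dir he hx, sk.mvfderiv_eq_dir he hx, sf.mvfderiv_eq_dir he hx,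
      sw.mvfderiv_eq_dir he hx]
    change dir _ (fun y => ((connCoef Φ vE2 ∘ e.symm) y *
      (connCoef Φ vE2 ∘ e.symm) y + (9 * (meanCurv Φ ∘ e.symm) y *
      (meanCurv Φ ∘ e.symm) y + ((shapeCoef Φ vE4 ∘ e.symm) y *
      (shapeCoef Φ vE4 ∘ e.symm) y + -1))) *
      (meanCurv Φ ∘ e.symm) y ^ (-(3 / 2) : ℝ)) x = _
    rw [dir_mul ho (sh3 e he) (srp e he) hx,
      dir_add ho ((sw e he).mul (sw e he)) (sh2 e he) hx,
      dir_add ho ((s9 e he).mul (sf e he)) (sh1 e he) hx,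
      dir_add ho ((sk e he).mul (sk e he)) contDiffOn_const hx,
      dir_mul ho (sw e he) (sw e he) hx, dir_mul ho (s9 e he) (sf e he) hx,
      dir_mul ho (sk e he) (sk e he) hx, dir_const_mul,
      dir_const_on ho (fun _ _ => rfl) hx,
      dir_rpow ho (sf e he) (fun x _ => hΦ.meanCurv_pos _) hx]
    simp only [Function.comp_apply]
    ring
  have hconst := hΦ.const_of_derivs hE2 hE4 sh
    (fun q => by
      obtain ⟨d1, d2, -, d4, -⟩ := hΦ.scalar_derivs hE2 hE4 q
      have f0 := (hΦ.meanCurv_pos q).ne'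
      rw [hder, d1, d2, d4]; field_simp; ring)
    (fun q => by
      obtain ⟨-, -, d3, -, d5⟩ := hΦ.scalar_derivs hE2 hE4 q
      rw [hder, d3, d5, hΦ.mvfderiv_meanCurv_vE2 hE2]; ring)
  rcases isEmpty_or_nonempty M with hM | ⟨⟨p₀⟩⟩
  · exact ⟨0, fun q => hM.elim q⟩
  refine ⟨h p₀ / 9, fun q => ?_⟩
  have hp := Real.rpow_pos_of_pos (hΦ.meanCurv_pos q) (3 / 2)
  rw [hconst p₀ q, hh]
  simp only
  rw [Real.rpow_neg (hΦ.meanCurv_pos q).le]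
  field_simp
  ring

/-- The ordinary differential equation for the mean curvature function along `E₁`. -/
theorem meanCurv_ode (hΦ : IsPNMCBiconservative Φ) (hE2 : IsE2 Φ vE2) (hE4 : IsE4 Φ vE4) {c C : ℝ}
    (hc : ∀ q, shapeCoef Φ vE4 q = c * meanCurv Φ q ^ (3 / 2 : ℝ))
    (hC : ∀ q, connCoef Φ vE2 q ^ 2 = 1 + 9 * C * meanCurv Φ q ^ (3 / 2 : ℝ)
      - 9 * meanCurv Φ q ^ 2 - shapeCoef Φ vE4 q ^ 2) (q : M) :
    mvfderiv (𝓡 2) (meanCurv Φ) q (vE1 Φ q) = 4 / 3 * meanCurv Φ q *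
      Real.sqrt (1 + 9 * C * meanCurv Φ q ^ (3 / 2 : ℝ) - 9 * meanCurv Φ q ^ 2
        - c ^ 2 * meanCurv Φ q ^ 3) := by
  have f0 := hΦ.meanCurv_pos q
  have h1 := (hΦ.scalar_derivs hE2 hE4 q).1
  have h2 := hΦ.mvfderiv_meanCurv_vE1_pos hE2 q
  -- The first integral gives only $w^2$; the sign follows from $E_1f=-\frac43fw>0$.
  have hw : 0 < -connCoef Φ vE2 q := by
    rw [h1] at h2
    by_contra! hneg
    nlinarith
  have h3 : (meanCurv Φ q ^ (3 / 2 : ℝ)) ^ 2 = meanCurv Φ q ^ 3 := by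
    rw [← Real.rpow_natCast, ← Real.rpow_mul f0.le, ← Real.rpow_natCast]
    norm_num
  have h4 := hC q
  rw [hc, mul_pow, h3] at h4
  rw [← h4, ← neg_sq, Real.sqrt_sq hw.le, h1]
  ring

end IsPNMCBiconservative

open Filter Topology

/-! ### Curves governed by the Frenet-type system -/

/-- The difference quotients lie in `D`, and a finite-dimensional subspace is closed. -/
theorem hasDerivAt_mem_submodule {G : Type*} [NormedAddCommGroup G] [NormedSpace ℝ G]
    [FiniteDimensional ℝ G] {g : ℝ → G} {g' : G} {u : ℝ} {D : Submodule ℝ G}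
    (hg : HasDerivAt g g' u) (h : ∀ᶠ v in 𝓝 u, g v - g u ∈ D) : g' ∈ D := by
  refine D.closed_of_finiteDimensional.mem_of_tendsto (hasDerivAt_iff_tendsto_slope.1 hg) ?_
  filter_upwards [nhdsWithin_le_nhds h] with v hv
  rw [slope_def_module]
  exact D.smul_mem _ hv

theorem not_linearIndependent_of_finrank_eq_two {G : Type*} [AddCommGroup G] [Module ℝ G]
    [FiniteDimensional ℝ G] {D : Submodule ℝ G} (hD : Module.finrank ℝ D = 2) {x y z : G}
    (hx : x ∈ D) (hy : y ∈ D) (hz : z ∈ D) : ¬ LinearIndependent ℝ ![x, y, z] := fun h => by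
  have hle : Submodule.span ℝ (Set.range ![x, y, z]) ≤ D := by
    rw [Submodule.span_le, Set.range_subset_iff]
    intro i
    fin_cases i <;> assumption
  have := Submodule.finrank_mono hle
  rw [finrank_span_eq_card h, hD] at this
  simp at this

/-- A curve in `ℍ⁴` with an adapted frame which satisfies the Frenet type equations of the integral
curves of `E₁`. -/
structure FrameCurve (J : Set ℝ) (γ T B N₃ N₄ : ℝ → R51) (f f' : ℝ → ℝ) (c : ℝ) : Prop where
  isOpen : IsOpen J
  frame : ∀ u ∈ J, IsFrame (γ u) (T u) (B u) (N₃ u) (N₄ u)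
  deriv_curve : ∀ u ∈ J, HasDerivAt γ (T u) u
  -- The power $f^{3/2}$ is written $f\sqrt f$, so that the later algebra needs only $(\sqrt
  -- f)^2=f$.
  deriv_tangent : ∀ u ∈ J,
    HasDerivAt T (γ u + -f u • N₃ u + (c * (f u * Real.sqrt (f u))) • N₄ u) u
  deriv_three : ∀ u ∈ J, HasDerivAt N₃ (f u • T u) u
  deriv_four : ∀ u ∈ J, HasDerivAt N₄ (-(c * (f u * Real.sqrt (f u))) • T u) u
  deriv_fun : ∀ u ∈ J, HasDerivAt f (f' u) u
  fun_pos : ∀ u ∈ J, 0 < f u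
  deriv_pos : ∀ u ∈ J, 0 < f' u

namespace FrameCurve

variable {J : Set ℝ} {γ T B N₃ N₄ : ℝ → R51} {f f' : ℝ → ℝ} {c : ℝ} {u : ℝ}

/-- The summand $\gamma$ of $T'$ is normal to $\mathbb H^4$ and is removed by the projection. -/
theorem covAlong_deriv (h : FrameCurve J γ T B N₃ N₄ f f' c) (hu : u ∈ J) :
    covAlong γ (deriv γ) u = -f u • N₃ u + (c * (f u * Real.sqrt (f u))) • N₄ u := by
  have e : deriv γ =ᶠ[𝓝 u] T := by
    filter_upwards [h.isOpen.mem_nhds hu] with v hv using (h.deriv_curve v hv).deriv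
  have F := h.frame u hu
  rw [covAlong, e.deriv_eq, (h.deriv_tangent u hu).deriv, projH4]
  simp only [mink_add_left, mink_smul_left, mink_comm (N₃ u), mink_comm (N₄ u), F.qq, F.q3, F.q4]
  module

theorem curvature_eq (h : FrameCurve J γ T B N₃ N₄ f f' c) (hu : u ∈ J) :
    curvature γ u = f u * Real.sqrt (1 + c ^ 2 * f u) := by
  have F := h.frame u hu
  have hf := h.fun_pos u hu
  rw [curvature, h.covAlong_deriv hu]
  simp only [mink_add_left, mink_add_right, mink_smul_left, mink_smul_right, mink_comm (N₄ u),
    F.h33, F.h34, F.h44]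
  conv_rhs => rw [← Real.sqrt_sq hf.le, ← Real.sqrt_mul (sq_nonneg _)]
  rw [Real.sqrt_sq hf.le]
  congr 1
  have := Real.sq_sqrt hf.le
  linear_combination c ^ 2 * f u ^ 2 * this

theorem principalNormal_eq (h : FrameCurve J γ T B N₃ N₄ f f' c) (hu : u ∈ J) :
    principalNormal γ u = (-(Real.sqrt (1 + c ^ 2 * f u))⁻¹) • N₃ u +
      (c * Real.sqrt (f u) * (Real.sqrt (1 + c ^ 2 * f u))⁻¹) • N₄ u := by
  have hf := h.fun_pos u hu
  have hs : 0 < Real.sqrt (1 + c ^ 2 * f u) := Real.sqrt_pos.2 (by positivity)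
  rw [principalNormal, h.curvature_eq hu, h.covAlong_deriv hu, smul_add, smul_smul, smul_smul]
  congr 2 <;> field_simp

/-- The derivatives of $N_3$ and $N_4$ are multiples of $T$ and contribute exactly $-\kappa T$. Only
the derivatives of the two coefficients of the principal normal remain. -/
theorem covAlong_principalNormal (h : FrameCurve J γ T B N₃ N₄ f f' c) (hu : u ∈ J) :
    covAlong γ (principalNormal γ) u + curvature γ u • deriv γ u =
      (c ^ 2 * f' u / (2 * Real.sqrt (1 + c ^ 2 * f u) ^ 3)) • N₃ u +
      (c * f' u / (2 * Real.sqrt (f u) * Real.sqrt (1 + c ^ 2 * f u) ^ 3)) • N₄ u := by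
  have F := h.frame u hu
  have hf := h.fun_pos u hu
  have h1 : 0 < 1 + c ^ 2 * f u := by positivity
  have hs : 0 < Real.sqrt (1 + c ^ 2 * f u) := Real.sqrt_pos.2 h1
  have hr : 0 < Real.sqrt (f u) := Real.sqrt_pos.2 hf
  have hs2 := Real.sq_sqrt h1.le
  have hr2 := Real.sq_sqrt hf.le
  have e : principalNormal γ =ᶠ[𝓝 u] fun v => (-(Real.sqrt (1 + c ^ 2 * f v))⁻¹) • N₃ v +
      (c * Real.sqrt (f v) * (Real.sqrt (1 + c ^ 2 * f v))⁻¹) • N₄ v := by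
    filter_upwards [h.isOpen.mem_nhds hu] with v hv using h.principalNormal_eq hv
  have ds := ((((h.deriv_fun u hu).const_mul (c ^ 2)).const_add 1).sqrt h1.ne').inv hs.ne'
  have dr := ((h.deriv_fun u hu).sqrt hf.ne').const_mul c
  have dN := (ds.neg.smul (h.deriv_three u hu)).add ((dr.mul ds).smul (h.deriv_four u hu))
  have hd : deriv (principalNormal γ) u = _ := e.deriv_eq.trans dN.deriv
  rw [covAlong, hd, projH4, h.curvature_eq hu, (h.deriv_curve u hu).deriv]
  simp only [Pi.mul_apply, Pi.neg_apply, Pi.inv_apply, mink_add_left, mink_smul_left,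
    mink_comm (N₃ u), mink_comm (N₄ u), mink_comm (T u), F.q1, F.q3, F.q4]
  set s := Real.sqrt (1 + c ^ 2 * f u)
  set r := Real.sqrt (f u)
  -- With $r=\sqrt f$ and $s=\sqrt{1+c^2f}$, `e3` and `e4` simplify the derivatives of the
  -- coefficients $-1/s$ and $cr/s$, and `e1` is the cancellation along $T$; `e4` and `e1` rest on
  -- $s^2=1+c^2r^2$.
  have e3 : c ^ 2 * f' u / (2 * s) / s ^ 2 = c ^ 2 * f' u / (2 * s ^ 3) := by field_simp
  have e4 : c * (f' u / (2 * r)) * s⁻¹ + c * r * (-(c ^ 2 * f' u / (2 * s)) / s ^ 2) =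
      c * f' u / (2 * r * s ^ 3) := by
    field_simp
    linear_combination c * f' u * hs2 - c ^ 3 * f' u * hr2
  have e1 : -s⁻¹ * f u + c * r * s⁻¹ * -(c * (f u * r)) + f u * s = 0 := by
    field_simp
    linear_combination f u * hs2 - c ^ 2 * f u * hr2
  rw [← e3, ← e4]
  linear_combination (norm := module) e1 • T u

theorem torsion_eq (h : FrameCurve J γ T B N₃ N₄ f f' c) (hu : u ∈ J) :
    torsion γ u = |c| * f' u / (2 * Real.sqrt (f u) * (1 + c ^ 2 * f u)) := by
  have F := h.frame u hu
  have hf := h.fun_pos u hu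
  have hf' := h.deriv_pos u hu
  have h1 : 0 < 1 + c ^ 2 * f u := by positivity
  have hs : 0 < Real.sqrt (1 + c ^ 2 * f u) := Real.sqrt_pos.2 h1
  have hr : 0 < Real.sqrt (f u) := Real.sqrt_pos.2 hf
  have hs2 := Real.sq_sqrt h1.le
  have hr2 := Real.sq_sqrt hf.le
  rw [torsion, h.covAlong_principalNormal hu]
  have hp : 0 ≤ |c| * f' u / (2 * Real.sqrt (f u) * (1 + c ^ 2 * f u)) := by positivity
  rw [← Real.sqrt_sq hp]
  congr 1
  simp only [mink_add_left, mink_add_right, mink_smul_left, mink_smul_right, mink_comm (N₄ u),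
    F.h33, F.h34, F.h44]
  rw [div_pow, mul_pow, sq_abs]
  generalize Real.sqrt (1 + c ^ 2 * f u) = s at *
  generalize Real.sqrt (f u) = r at *
  rw [← hs2]
  field_simp
  linear_combination c ^ 4 * hr2 - c ^ 2 * hs2

/-- In an affine plane the derivatives $\gamma',\gamma'',\gamma'''$ would all lie in the
two-dimensional direction space. They are independent: $\gamma''$ alone has a component along
$\gamma$, and $\gamma'''$ has the component $-f'\neq0$ along $N_3$. -/
theorem not_forall_mem_plane (h : FrameCurve J γ T B N₃ N₄ f f' c) (hu : u ∈ J)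
    {A : AffineSubspace ℝ R51} (hA : Module.finrank ℝ A.direction = 2) :
    ¬ ∀ v ∈ J, γ v ∈ A := fun hγ => by
  have hT : ∀ v ∈ J, T v ∈ A.direction := fun v hv =>
    hasDerivAt_mem_submodule (h.deriv_curve v hv) <| by
      filter_upwards [h.isOpen.mem_nhds hv] with w hw
      exact A.vsub_mem_direction (hγ w hw) (hγ v hv)
  have hT' : ∀ v ∈ J,
      γ v + -f v • N₃ v + (c * (f v * Real.sqrt (f v))) • N₄ v ∈ A.direction := fun v hv =>
    hasDerivAt_mem_submodule (h.deriv_tangent v hv) <| by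
      filter_upwards [h.isOpen.mem_nhds hv] with w hw
      exact sub_mem (hT w hw) (hT v hv)
  have F := h.frame u hu
  have df := h.deriv_fun u hu
  have dk := (df.mul (df.sqrt (h.fun_pos u hu).ne')).const_mul c
  have d := ((h.deriv_curve u hu).add (df.neg.smul (h.deriv_three u hu))).add
    (dk.smul (h.deriv_four u hu))
  have hT'' := hasDerivAt_mem_submodule (D := A.direction) d <| by
    filter_upwards [h.isOpen.mem_nhds hu] with w hw
    exact sub_mem (hT' w hw) (hT' u hu)
  simp only [Pi.mul_apply, Pi.neg_apply] at hT''
  -- The coefficients are arbitrary because independence uses only the $\gamma$, $N_3$ and $T$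
  -- components, in this order.
  have key : ∀ a k l k' : ℝ, LinearIndependent ℝ ![T u, γ u + a • N₃ u + k • N₄ u,
      T u + (a • f u • T u + -f' u • N₃ u) + (k • l • T u + k' • N₄ u)] := fun a k l k' => by
    rw [Fintype.linearIndependent_iff]
    intro g hg
    simp only [Fin.sum_univ_three, Matrix.cons_val] at hg
    have p0 := congrArg (fun x => mink x (γ u)) hg
    have p3 := congrArg (fun x => mink x (N₃ u)) hg
    have p1 := congrArg (fun x => mink x (T u)) hg
    simp only [mink_add_left, mink_smul_left, mink_zero_left, mink_comm (T u) (γ u),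
      mink_comm (N₃ u) (γ u), mink_comm (N₄ u) (γ u), mink_comm (N₃ u) (T u),
      mink_comm (N₄ u) (T u), mink_comm (N₄ u) (N₃ u),
      F.qq, F.q1, F.q3, F.q4, F.h11, F.h13, F.h14, F.h33, F.h34] at p0 p1 p3
    have g1 : g 1 = 0 := by linarith
    have g2 : g 2 = 0 := by
      have : g 2 * f' u = 0 := by rw [g1] at p3; linarith
      exact (mul_eq_zero.1 this).resolve_right (h.deriv_pos u hu).ne'
    have g0 : g 0 = 0 := by rw [g1, g2] at p1; linarith
    intro i
    fin_cases i <;> assumption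
  have hli := key (-f u) (c * (f u * Real.sqrt (f u))) (-(c * (f u * Real.sqrt (f u))))
    (c * (f' u * Real.sqrt (f u) + f u * (f' u / (2 * Real.sqrt (f u)))))
  exact not_linearIndependent_of_finrank_eq_two hA (hT u hu) (hT' u hu) hT'' hli

end FrameCurve

/-! ### Integral curves of $E_1$ -/

theorem ChartSmooth.hasDerivAt_comp {M : Type*} [TopologicalSpace M] [ChartedSpace E2 M]
    [IsManifold (𝓡 2) ∞ M] {G : Type*} [NormedAddCommGroup G] [NormedSpace ℝ G] {h : M → G}
    (hh : ChartSmooth h) {v : (p : M) → TangentSpace (𝓡 2) p} {J : Set ℝ} (hJ : IsOpen J)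
    {σ : ℝ → M} (hσ : IsMIntegralCurveOn σ v J) {u : ℝ} (hu : u ∈ J) :
    HasDerivAt (h ∘ σ) (mvfderiv (𝓡 2) h (σ u) (v (σ u))) u := by
  have h1 := (hσ u hu).hasMFDerivAt (hJ.mem_nhds hu)
  have h2 := (hh.hasMFDerivAt (σ u)).comp u h1
  -- Stated on the model plane, so that the tangent spaces in the manifold chain rule are identified
  -- with `E2` when it is applied.
  have h3 : ∀ (L : E2 →L[ℝ] G) (w : E2), HasFDerivAt (h ∘ σ)
      (L.comp ((1 : ℝ →L[ℝ] ℝ).smulRight w)) u → HasDerivAt (h ∘ σ) (L w) u := fun L w hL => by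
    simpa using hL.hasDerivAt
  exact h3 _ _ (hasMFDerivAt_iff_hasFDerivAt.1 h2)

namespace IsPNMCBiconservative

variable {M : Type*} [TopologicalSpace M] [ChartedSpace E2 M] [IsManifold (𝓡 2) ∞ M]
  {Φ : M → R51} {vE2 : (p : M) → TangentSpace (𝓡 2) p} {vE4 : M → R51}

theorem frameCurve (hΦ : IsPNMCBiconservative Φ) (hE2 : IsE2 Φ vE2) (hE4 : IsE4 Φ vE4) {c : ℝ}
    (hc : ∀ q, shapeCoef Φ vE4 q = c * meanCurv Φ q ^ (3 / 2 : ℝ)) {J : Set ℝ} (hJ : IsOpen J)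
    {σ : ℝ → M} (hσ : IsMIntegralCurveOn σ (vE1 Φ) J) :
    FrameCurve J (Φ ∘ σ) (tanVec Φ (vE1 Φ) ∘ σ) (tanVec Φ vE2 ∘ σ) (vE3 Φ ∘ σ) (vE4 ∘ σ)
      (meanCurv Φ ∘ σ) (fun u => mvfderiv (𝓡 2) (meanCurv Φ) (σ u) (vE1 Φ (σ u))) c := by
  have hk : ∀ q, c * (meanCurv Φ q * Real.sqrt (meanCurv Φ q)) = shapeCoef Φ vE4 q := fun q => by
    have f0 := hΦ.meanCurv_pos q
    rw [hc, Real.sqrt_eq_rpow]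
    congr 1
    nth_rewrite 1 [← Real.rpow_one (meanCurv Φ q)]
    rw [← Real.rpow_add f0]
    norm_num
  have sX : ChartSmooth Φ := fun _ he => (hΦ.isPNMC_chart hE2 hE4 he).sX
  have s3 : ChartSmooth (vE3 Φ) := fun _ he => (hΦ.isPNMC_chart hE2 hE4 he).s3
  have s4 : ChartSmooth vE4 := fun _ he => (hΦ.isPNMC_chart hE2 hE4 he).s4
  refine ⟨hJ, fun u _ => hΦ.isFrame hE2 hE4 (σ u), fun u hu => sX.hasDerivAt_comp hJ hσ hu,
    fun u hu => ?_, fun u hu => ?_, fun u hu => ?_,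
    fun u hu => (hΦ.chartSmooth_meanCurv hE2).hasDerivAt_comp hJ hσ hu,
    fun u _ => hΦ.meanCurv_pos _, fun u _ => hΦ.mvfderiv_meanCurv_vE1_pos hE2 _⟩
  all_goals
    obtain ⟨d1, -, d3, d4, -⟩ := hΦ.frame_derivs hE2 hE4 (σ u)
  · have := (hΦ.chartSmooth_tanVec_vE1 hE2 hE4).hasDerivAt_comp hJ hσ hu
    rw [d1, ← hk] at this
    exact this
  · have := s3.hasDerivAt_comp hJ hσ hu
    rw [d3] at this
    exact this
  · have := s4.hasDerivAt_comp hJ hσ hu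
    rw [d4, ← hk] at this
    exact this

theorem tanVec_vE2_const (hΦ : IsPNMCBiconservative Φ) (hE2 : IsE2 Φ vE2) (hE4 : IsE4 Φ vE4)
    {J : Set ℝ} (hJ : IsOpen J) (hJc : J.OrdConnected) {σ : ℝ → M}
    (hσ : IsMIntegralCurveOn σ (vE1 Φ) J) {u v : ℝ} (hu : u ∈ J) (hv : v ∈ J) :
    tanVec Φ vE2 (σ u) = tanVec Φ vE2 (σ v) := by
  have s2 : ChartSmooth (tanVec Φ vE2) := fun _ he => (hΦ.isPNMC_chart hE2 hE4 he).s2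
  have hd : ∀ w ∈ J, HasDerivAt (tanVec Φ vE2 ∘ σ) 0 w := fun w hw => by
    have := s2.hasDerivAt_comp hJ hσ hw
    rwa [(hΦ.frame_derivs hE2 hE4 (σ w)).2.1] at this
  exact hJ.is_const_of_deriv_eq_zero hJc.isPreconnected
    (fun w hw => (hd w hw).differentiableAt.differentiableWithinAt) (fun w hw => (hd w hw).deriv)
    hu hv

end IsPNMCBiconservative

end Biconservative

theorem proposition3p2 {M : Type*} [TopologicalSpace M] [ChartedSpace E2 M]
    [IsManifold (𝓡 2) ∞ M] [ConnectedSpace M]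
    (Φ : M → R51) (hΦ : IsPNMCBiconservative Φ)
    (vE2 : (p : M) → TangentSpace (𝓡 2) p) (hE2 : IsE2 Φ vE2)
    (vE4 : M → R51) (hE4 : IsE4 Φ vE4) :
    ∃ c C : ℝ, c ≠ 0 ∧
      -- `c` is the constant in the shape operator `A₄ = diag (c f^{3/2}, -c f^{3/2})`
      (∀ p, mink (secondFF Φ p (vE1 Φ p)
              (vE1 Φ p)) (vE4 p) = c * meanCurv Φ p ^ (3 / 2 : ℝ) ∧
          mink (secondFF Φ p (vE1 Φ p)
              (vE2 p)) (vE4 p) = 0 ∧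
          mink (secondFF Φ p (vE2 p) (vE2 p)) (vE4 p)
            = -(c * meanCurv Φ p ^ (3 / 2 : ℝ))) ∧
      -- `C` is the constant in the first integral for `E₁ f`
      (∀ p, mvfderiv (𝓡 2) (meanCurv Φ) p (vE1 Φ p) =
          4 / 3 * meanCurv Φ p *
            Real.sqrt (1 + 9 * C * meanCurv Φ p ^ (3 / 2 : ℝ)
              - 9 * meanCurv Φ p ^ 2 - c ^ 2 * meanCurv Φ p ^ 3)) ∧
      ∀ (J : Set ℝ) (σ : ℝ → M), IsOpen J → J.OrdConnected → J.Nonempty →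
        IsMIntegralCurveOn σ (vE1 Φ) J →
        -- (i) `E₂` is constant along the curve
        (∀ u ∈ J, ∀ v ∈ J,
          mvfderiv (𝓡 2) Φ (σ u) (vE2 (σ u)) = mvfderiv (𝓡 2) Φ (σ v) (vE2 (σ v))) ∧
        -- (ii) the curve lies in a totally geodesic `ℍ³ = ℍ⁴ ∩ P`, with the hyperplane `P` orthogonal to `E₂`
        (∃ P : Submodule ℝ R51, Module.finrank ℝ P = 4 ∧
          (∀ u ∈ J, ∀ x ∈ P, mink x (mvfderiv (𝓡 2) Φ (σ u) (vE2 (σ u))) = 0) ∧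
          IsTotallyGeodesicH3
            (H4 ∩ (P : Set R51)) ∧
          ∀ u ∈ J, Φ (σ u) ∈ H4 ∩ (P : Set R51)) ∧
        -- (iii) the curve lies in no two-dimensional affine subspace
        (∀ A : AffineSubspace ℝ R51, Module.finrank ℝ A.direction = 2 →
          ¬ ∀ u ∈ J, Φ (σ u) ∈ A) ∧
        -- (iv) curvature and torsion
        (∀ u ∈ J, curvature (Φ ∘ σ) u =
            meanCurv Φ (σ u) *
              Real.sqrt (1 + c ^ 2 * meanCurv Φ (σ u)) ∧
          torsion (Φ ∘ σ) u =
            2 * |c| * Real.sqrt (meanCurv Φ (σ u)) /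
                (3 * (1 + c ^ 2 * meanCurv Φ (σ u))) *
              Real.sqrt (1 + 9 * C * meanCurv Φ (σ u) ^ (3 / 2 : ℝ)
                - 9 * meanCurv Φ (σ u) ^ 2
                - c ^ 2 * meanCurv Φ (σ u) ^ 3)) := by
  obtain ⟨c, hc0, hc⟩ := hΦ.exists_shape_const hE2 hE4
  obtain ⟨C, hC⟩ := hΦ.exists_first_integral hE2 hE4
  have ode := hΦ.meanCurv_ode hE2 hE4 hc hC
  refine ⟨c, C, hc0, fun p => ?_, ode, fun J σ hJ hJc ⟨u₀, hu₀⟩ hσ => ?_⟩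
  · rw [← hc]
    exact hΦ.secondFF_vE4 hE2 hE4 p
  have hconst := fun u (hu : u ∈ J) v (hv : v ∈ J) => hΦ.tanVec_vE2_const hE2 hE4 hJ hJc hσ hu hv
  have F := hΦ.frameCurve hE2 hE4 hc hJ hσ
  refine ⟨hconst, ?_, fun A hA => F.not_forall_mem_plane hu₀ hA, fun u hu =>
    ⟨F.curvature_eq hu, ?_⟩⟩
  · have hB : tanVec Φ vE2 (σ u₀) ≠ 0 := fun h0 => by
      have := (F.frame u₀ hu₀).h22
      rw [Function.comp_apply, h0, mink_zero_left] at this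
      exact zero_ne_one this
    -- The hyperplane is the orthogonal complement of $E_2$ at one parameter; constancy of $E_2$
    -- makes it the complement at every parameter, and the position vector is orthogonal to $E_2$.
    obtain ⟨P, hP, hmem⟩ := exists_hyperplane hB
    have hγ : ∀ u ∈ J, Φ (σ u) ∈ P := fun u hu => by
      rw [hmem, hconst u₀ hu₀ u hu]
      exact (F.frame u hu).q2
    refine ⟨P, hP, fun u hu x hx => ?_,
      isTotallyGeodesic_of_mem hP (hΦ.mem_H4 _) (hγ u₀ hu₀), fun u hu => ⟨hΦ.mem_H4 _, hγ u hu⟩⟩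
    have := (hmem x).1 hx
    rwa [hconst u₀ hu₀ u hu] at this
  · have hf := hΦ.meanCurv_pos (σ u)
    have hr : 0 < Real.sqrt (meanCurv Φ (σ u)) := Real.sqrt_pos.2 hf
    have hr2 := Real.sq_sqrt hf.le
    have h1 : 0 < 1 + c ^ 2 * meanCurv Φ (σ u) := by positivity
    -- Substituting $f'=\frac43fS$ in $|c|f'/(2\sqrt f(1+c^2f))$ and using $f=(\sqrt f)^2$ gives the
    -- stated torsion.
    rw [F.torsion_eq hu, ode, Function.comp_apply]
    generalize Real.sqrt (1 + 9 * C * meanCurv Φ (σ u) ^ (3 / 2 : ℝ) - 9 * meanCurv Φ (σ u) ^ 2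
      - c ^ 2 * meanCurv Φ (σ u) ^ 3) = S
    rw [div_mul_eq_mul_div (2 * |c| * _), div_eq_div_iff (by positivity) (by positivity)]
    linear_combination (-4 * |c| * S * (1 + c ^ 2 * meanCurv Φ (σ u))) * hr2
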